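/- Let $\lg$ denote $\log_2$, let $[m]=\{0,\dots,m-1\}$, and let $\mathcal B(n,m)=\lceil \lg\binom{m}{n}\rceil$. For a finite set $S$ of natural numbers let $\mathrm{rank}(x,S)=|\{y\in S: y<x\}|$ if $x\in S$ and $\mathrm{rank}(x,S)=-1$ otherwise, and for $1\le i\le |S|$ let $\mathrm{select}(i,S)$ be the $i$-th smallest element of $S$. The model of computation is the word RAM with word size $w=\Theta(\lg m)$: memory cells and registers hold $w$-bit words, with unit-cost arithmetic, bitwise, shift, comparison, jump and memory access instructions. There are four fixed word RAM programs and a constant $T$ such that for every $c$ there is a constant $C$ with the following property. Let $m\ge 3$, let the word size $w$ satisfy $m<2^w$ and $w\le c\lg m$, and let $S\subseteq[m]$ with $|S|=n$ and $\bar S=[m]\setminus S$. Then there is a bit string of length at most $$\mathcal B(n,m)+C\,\frac{m\lg\lg m}{\lg m}$$ such that, when it is stored in memory packed into $w$-bit words (followed by zeros), the four programs answer the queries $\mathrm{rank}(x,S)$ and $\mathrm{rank}(x,\bar S)$ for all $x\in[m]$, $\mathrm{select}(i,S)$ for all $1\le i\le n$, and $\mathrm{select}(i,\bar S)$ for all $1\le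 i\le m-n$, each within $T$ steps. That is, every $S\subseteq[m]$ with $|S|=n$ has a fully indexable dictionary (constant-time rank and select on $S$ and on its complement) using $\mathcal B(n,m)+O(m\lg\lg m/\lg m)$ bits. -/

import Mathlib

namespace FID

/-! ### The word RAM

A program is a fixed finite list of instructions.  It does not depend on the word size `w`; on a
machine of word size `w` all registers and all memory cells hold `w`-bit words. -/

/-- The arithmetic and bitwise instructions of the word RAM (all modulo `2 ^ w`). -/
inductive BinOp
  | add | sub | mul | div | mod | and | or | xor | shl | shr

/-- Words are unsigned; `x / 0 = 0`, `x % 0 = x`, and a shift by `w` or more gives `0`. -/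
def BinOp.eval {w : ℕ} : BinOp → BitVec w → BitVec w → BitVec w
  | .add, x, y => x + y
  | .sub, x, y => x - y
  | .mul, x, y => x * y
  | .div, x, y => x / y
  | .mod, x, y => x % y
  | .and, x, y => x &&& y
  | .or, x, y => x ||| y
  | .xor, x, y => x ^^^ y
  | .shl, x, y => x <<< y
  | .shr, x, y => x >>> y

/-- Instructions; `d`, `a`, `b` are names of registers, `t` is a line of the program.
There is no instruction that writes to memory: a query only reads the data structure, and its
working space is the registers that the program mentions. -/
inductive Instr
  /-- `d := k` -/
  | const (d k : ℕ)
  /-- `d := memory[a]` -/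
  | load (d a : ℕ)
  /-- `d := a o b` -/
  | op (o : BinOp) (d a b : ℕ)
  /-- go to line `t` -/
  | jump (t : ℕ)
  /-- if `a = b` go to line `t` -/
  | jeq (a b t : ℕ)
  /-- if `a < b` (unsigned) go to line `t` -/
  | jlt (a b t : ℕ)
  /-- stop with answer `a` -/
  | halt (a : ℕ)

abbrev Program := List Instr

/-- `run P mem T pc reg` executes `P` from line `pc` with registers `reg`, one time unit per
instruction.  It is `some y` if the program stops within `T` time units with answer `y`, and
`none` if it does not (or if it leaves the program). -/
def run {w : ℕ} (P : Program) (mem : ℕ → BitVec w) :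
    ℕ → ℕ → (ℕ → BitVec w) → Option (BitVec w)
  | 0, _, _ => none
  | T + 1, pc, reg =>
    match P[pc]? with
    | none => none
    | some (.const d k) => run P mem T (pc + 1) (Function.update reg d (BitVec.ofNat w k))
    | some (.load d a) => run P mem T (pc + 1) (Function.update reg d (mem (reg a).toNat))
    | some (.op o d a b) =>
        run P mem T (pc + 1) (Function.update reg d (o.eval (reg a) (reg b)))
    | some (.jump t) => run P mem T t reg
    | some (.jeq a b t) => run P mem T (if reg a = reg b then t else pc + 1) reg
    | some (.jlt a b t) =>
        run P mem T (if (reg a).toNat < (reg b).toNat then t else pc + 1) reg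
    | some (.halt a) => some (reg a)

/-- A bit string stored in consecutive memory cells, `w` bits per cell, least significant bit
first; all bits after its end are `0`. -/
def memOf (w : ℕ) (D : List Bool) (j : ℕ) : BitVec w :=
  BitVec.ofFnLE fun i : Fin w => D.getD (j * w + i) false

/-- On word size `w` and with the bit string `D` in memory, `P` answers the query `x` with `y`
within `T` time units.  The query is in register `0`; all other registers are initially `0`. -/
def Answers (P : Program) (T w : ℕ) (D : List Bool) (x : ℕ) (y : ℤ) : Prop :=
  run P (memOf w D) T 0 (Function.update (fun _ => 0) 0 (BitVec.ofNat w x)) =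
    some (BitVec.ofInt w y)

/-! ### Fully indexable dictionaries -/

/-- `-1` if `x ∉ S`, and the number of elements of `S` less than `x` otherwise. -/
def rank (x : ℕ) (S : Finset ℕ) : ℤ :=
  if x ∈ S then ((S.filter (· < x)).card : ℤ) else -1

/-- The `i`-th smallest element of `S`, for `1 ≤ i ≤ |S|`. -/
noncomputable def select (i : ℕ) (S : Finset ℕ) : ℕ :=
  Nat.nth (· ∈ S) (i - 1)

/-- The four query algorithms of a fully indexable dictionary. -/
structure Queries where
  rankS : Program
  selectS : Program
  rankCompl : Program
  selectCompl : Program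

/-- With the algorithms `Q`, on word size `w`, the bit string `D` is a representation of
`S ⊆ {0, …, m - 1}` that supports rank and select on `S` and on its complement, each query within
`T` time units.  (The answer `-1` is the word of `w` ones; it differs from every
number less than `m` if `m < 2 ^ w`.) -/
structure Represents (Q : Queries) (T w m : ℕ) (D : List Bool) (S : Finset ℕ) : Prop where
  rankS : ∀ x < m, Answers Q.rankS T w D x (rank x S)
  selectS : ∀ i, 1 ≤ i → i ≤ S.card → Answers Q.selectS T w D i (select i S)
  rankCompl : ∀ x < m, Answers Q.rankCompl T w D x (rank x (Finset.range m \ S))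
  selectCompl : ∀ i, 1 ≤ i → i ≤ (Finset.range m \ S).card →
    Answers Q.selectCompl T w D i (select i (Finset.range m \ S))

/-- Base two logarithm. -/
noncomputable def lg (x : ℝ) : ℝ := Real.logb 2 x

/-- The information-theoretic lower bound `⌈lg (m choose n)⌉`. -/
noncomputable def infoBound (n m : ℕ) : ℕ := ⌈lg (m.choose n)⌉₊

end FID

/-! Cut `[m]` into `M = m / t + 1` blocks of length `t = ⌊lg m⌋ / 8`. A block with `k` elements is
stored as `k` together with its number among the blocks of that cardinality, in `⌈lg (t choose k)⌉`
bits. By Vandermonde the product of these binomials over the full blocks is at most `m choose n`, so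
the codes cost the information bound plus one rounding bit per block and at most `t` bits for the
last, incomplete block (`blockPtr_le_infoBound`). Everything else must cost `O(f)` bits per block,
where `f = O(lg lg m)` and `t ^ 4 ≤ 2 ^ f`, since `M * f = O(m lg lg m / lg m)`.

Code positions and ranks at block boundaries grow by at most `t` per block, so a full word at every
`t`-th block and an `f`-bit difference at each block suffice (`Setup.ev_stepE`). Questions inside a
block are answered by a table indexed by cardinality, code and position; its size is a small power
of `m` (`Stored.ev_tableE`). This settles rank.

Select also needs the block containing the element with `i` predecessors. That is a monotone
sequence in `i` with up to `M * t` entries but total increase at most `M`, so its space must be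
charged to the increase and not to the number of entries (`Setup.ev_monoE`,
`mul_length_groupData_le`). Take groups of `t * t` entries. If a group increases by `t ^ 3` or more,
it is written out in words; this is `O(1)` bits per unit of increase because `w = O(t)`. Otherwise
all offsets in it fit into `f` bits, and it is split into subgroups of `t` entries. A subgroup of
increase `s ≥ t` is written out in `t * f ≤ s * f` bits. For `s < t` there are at most `(t + 1) ^ s`
and at most `2 ^ (t + s)` monotone sequences, so a code has at most `s * f` bits and is also shorter
than `2 * t` bits, short enough for table lookup.

A set and its complement share the block codes; only the auxiliary sections are doubled. The queries
are loop-free expressions, so program length bounds time (`Expr.compile_steps`); they read the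
parameters and addresses from a header. Universes below an absolute bound `N` are scanned
exhaustively, and the first memory word tells the two representations apart. The space used there is
bounded in terms of `c`, and `C` absorbs it because the redundancy is at least `lg (lg 3) > 0`. -/

namespace FID

/-! ### Expressions and their compilation -/

/-- Loop-free computations on a single argument. -/
inductive Expr
  | arg
  | const (k : ℕ)
  | load (e : Expr)
  | op (o : BinOp) (a b : Expr)
  /-- if `a < b` then `c` else `e` -/
  | ite (a b c e : Expr)

def Expr.eval {w : ℕ} (mem : ℕ → BitVec w) (x : BitVec w) : Expr → BitVec w
  | .arg => x
  | .const k => BitVec.ofNat w k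
  | .load e => mem (e.eval mem x).toNat
  | .op o a b => o.eval (a.eval mem x) (b.eval mem x)
  | .ite a b c e =>
      if (a.eval mem x).toNat < (b.eval mem x).toNat then c.eval mem x else e.eval mem x

/-- Code for an expression, placed at line `pc`; the value is left in register `d`, and the
registers between `0` and `d` are not changed. -/
def Expr.compile : Expr → ℕ → ℕ → List Instr
  | .arg, d, _ => [.op .or d 0 0]
  | .const k, d, _ => [.const d k]
  | .load e, d, pc => e.compile d pc ++ [.load d d]
  | .op o a b, d, pc =>
      let A := a.compile d pc
      let B := b.compile (d + 1) (pc + A.length)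
      A ++ B ++ [.op o d d (d + 1)]
  | .ite a b c e, d, pc =>
      let A := a.compile d pc
      let B := b.compile (d + 1) (pc + A.length)
      let q := pc + A.length + B.length
      let E := e.compile d (q + 1)
      let C := c.compile d (q + 1 + E.length + 1)
      A ++ B ++ [.jlt d (d + 1) (q + 1 + E.length + 1)] ++ E ++
        [.jump (q + 1 + E.length + 1 + C.length)] ++ C

/-- The list `Y` occurs in `D` at position `p`. -/
def At {α : Type*} (D : List α) (p : ℕ) (Y : List α) : Prop := Y <+: D.drop p

theorem At.left {α : Type*} {D : List α} {p : ℕ} {X Y : List α} (h : At D p (X ++ Y)) :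
    At D p X :=
  (List.prefix_append X Y).trans h

theorem At.right {α : Type*} {D : List α} {p : ℕ} {X Y : List α} (h : At D p (X ++ Y)) :
    At D (p + X.length) Y := by
  obtain ⟨Z, hZ⟩ := h
  refine ⟨Z, ?_⟩
  rw [← List.drop_drop, ← hZ, List.append_assoc, List.drop_left]

theorem At.getElem? {α : Type*} {D : List α} {p : ℕ} {Y : List α} (h : At D p Y) {i : ℕ}
    (hi : i < Y.length) : D[p + i]? = Y[i]? := by
  obtain ⟨Z, hZ⟩ := h
  rw [← List.getElem?_drop, ← hZ, List.getElem?_append_left hi]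

theorem At.head {α : Type*} {D : List α} {p : ℕ} {a : α} (h : At D p [a]) : D[p]? = some a := by
  simpa using h.getElem? (i := 0) (by simp)

theorem At.trans {α : Type*} {D Y Z : List α} {p q : ℕ} (h : At D p Y) (h' : At Y q Z) :
    At D (p + q) Z := by
  obtain ⟨A, hA⟩ := h
  obtain ⟨B, hB⟩ := h'
  rw [At, ← List.drop_drop, ← hA, List.drop_append, ← hB, List.append_assoc]
  exact List.prefix_append _ _

theorem run_succ_eq_of_eq_some {w : ℕ} {P : Program} {mem : ℕ → BitVec w} {y : BitVec w} :
    ∀ {T pc : ℕ} {reg : ℕ → BitVec w}, run P mem T pc reg = some y →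
      run P mem (T + 1) pc reg = some y := by
  intro T
  induction T with
  | zero => intro pc reg h; simp [run] at h
  | succ T ih =>
    intro pc reg h
    rw [run] at h ⊢
    cases hP : P[pc]? with
    | none => simp [hP] at h
    | some I =>
      rw [hP] at h
      cases I <;> first | exact ih h | exact h

theorem run_mono {w : ℕ} {P : Program} {mem : ℕ → BitVec w} {y : BitVec w} {T T' pc : ℕ}
    {reg : ℕ → BitVec w} (hT : T ≤ T') (h : run P mem T pc reg = some y) :
    run P mem T' pc reg = some y := by
  induction hT with
  | refl => exact h
  | step _ ih => exact run_succ_eq_of_eq_some ih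

/-- From line `pc` and registers `reg` the program arrives after `n` steps at `pc'`, `reg'`. -/
def Steps {w : ℕ} (P : Program) (mem : ℕ → BitVec w) (n pc : ℕ) (reg : ℕ → BitVec w)
    (pc' : ℕ) (reg' : ℕ → BitVec w) : Prop :=
  ∀ T, run P mem (T + n) pc reg = run P mem T pc' reg'

theorem Steps.trans {w : ℕ} {P : Program} {mem : ℕ → BitVec w} {n n' pc pc' pc'' : ℕ}
    {reg reg' reg'' : ℕ → BitVec w} (h : Steps P mem n pc reg pc' reg')
    (h' : Steps P mem n' pc' reg' pc'' reg'') : Steps P mem (n' + n) pc reg pc'' reg'' := by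
  intro T
  rw [← add_assoc, h, h']

theorem steps_jlt_of_lt {w : ℕ} {P : Program} {mem : ℕ → BitVec w} {pc a b t : ℕ}
    {reg : ℕ → BitVec w} (h : P[pc]? = some (.jlt a b t)) (hlt : (reg a).toNat < (reg b).toNat) :
    Steps P mem 1 pc reg t reg := by
  intro T
  rw [run, h]
  simp only [hlt, if_true]

theorem steps_jlt_of_not_lt {w : ℕ} {P : Program} {mem : ℕ → BitVec w} {pc a b t : ℕ}
    {reg : ℕ → BitVec w} (h : P[pc]? = some (.jlt a b t))
    (hlt : ¬ (reg a).toNat < (reg b).toNat) : Steps P mem 1 pc reg (pc + 1) reg := by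
  intro T
  rw [run, h]
  simp only [hlt, if_false]

/-- All jumps in compiled code go forward, so each line is executed at most once and the length of
the code bounds the time. The registers below `d` hold the argument and pending intermediate
results, as on a stack; the last clause keeps them alive. -/
theorem Expr.compile_steps {w : ℕ} (P : Program) (mem : ℕ → BitVec w) (e : Expr) :
    ∀ (d pc : ℕ) (reg : ℕ → BitVec w), 0 < d → At P pc (e.compile d pc) →
      ∃ n reg', n ≤ (e.compile d pc).length ∧
        Steps P mem n pc reg (pc + (e.compile d pc).length) reg' ∧
        reg' d = e.eval mem (reg 0) ∧ ∀ r < d, reg' r = reg r := by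
  induction e with
  | arg =>
    intro d pc reg hd h
    refine ⟨1, Function.update reg d (reg 0), by simp [compile], ?_, by simp [eval], ?_⟩
    · intro T
      rw [run, At.head h]
      simp [compile, BinOp.eval]
    · intro r hr; simp [hr.ne]
  | const k =>
    intro d pc reg hd h
    refine ⟨1, Function.update reg d (BitVec.ofNat w k), by simp [compile], ?_, by simp [eval], ?_⟩
    · intro T
      rw [run, At.head h]
      simp [compile]
    · intro r hr; simp [hr.ne]
  | load e ih =>
    intro d pc reg hd h
    rw [compile] at h
    obtain ⟨n, reg', hn, hs, hv, hr⟩ := ih d pc reg hd h.left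
    refine ⟨1 + n, Function.update reg' d (mem (reg' d).toNat), by simp [compile]; omega,
      hs.trans ?_, by simp [eval, hv], ?_⟩
    · intro T
      rw [run, At.head h.right]
      simp [compile, add_assoc]
    · intro r hr'; simp [hr'.ne, hr r hr']
  | op o a b iha ihb =>
    intro d pc reg hd h
    rw [compile] at h
    obtain ⟨n, reg', hn, hs, hv, hr⟩ := iha d pc reg hd h.left.left
    obtain ⟨n', reg'', hn', hs', hv', hr'⟩ := ihb (d + 1) _ reg' (by omega) h.left.right
    refine ⟨1 + (n' + n), Function.update reg'' d (o.eval (reg'' d) (reg'' (d + 1))),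
      by simp [compile]; omega, (hs.trans hs').trans ?_, ?_, ?_⟩
    · intro T
      have := At.head h.right
      rw [List.length_append, ← add_assoc] at this
      rw [run, this]
      simp [compile, add_assoc]
    · simp [eval, hv', hr' d (by omega), hv, hr 0 hd]
    · intro r hrd
      simp [hrd.ne, hr' r (by omega), hr r hrd]
  | ite a b c e iha ihb ihc ihe =>
    intro d pc reg hd h
    rw [compile] at h
    obtain ⟨n, reg', hn, hs, hv, hr⟩ := iha d pc reg hd h.left.left.left.left.left
    obtain ⟨n', reg'', hn', hs', hv', hr'⟩ :=
      ihb (d + 1) _ reg' (by omega) h.left.left.left.left.right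
    have hj := At.head h.left.left.left.right
    have hjump := At.head h.left.right
    have hE := h.left.left.right
    have hC := h.right
    simp only [List.length_append, List.length_singleton, ← add_assoc] at hj hjump hE hC
    obtain ⟨nc, regc, hnc, hsc, hvc, hrc⟩ := ihc d _ reg'' hd hC
    obtain ⟨ne, rege, hne, hse, hve, hre⟩ := ihe d _ reg'' hd hE
    have h0 : reg'' 0 = reg 0 := by rw [hr' 0 (by omega), hr 0 hd]
    have hcond : ((reg'' d).toNat < (reg'' (d + 1)).toNat) ↔
        (a.eval mem (reg 0)).toNat < (b.eval mem (reg 0)).toNat := by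
      rw [hv', hr' d (by omega), hv, hr 0 hd]
    by_cases hlt : (a.eval mem (reg 0)).toNat < (b.eval mem (reg 0)).toNat
    · have h1 := steps_jlt_of_lt (mem := mem) hj (hcond.mpr hlt)
      have h2 := ((hs.trans hs').trans h1).trans hsc
      refine ⟨nc + (1 + (n' + n)), regc, ?_, ?_, ?_, ?_⟩
      · simp only [compile, List.length_append, List.length_singleton]; omega
      · convert h2 using 1
        simp only [compile, List.length_append, List.length_singleton]; omega
      · simp [eval, hlt, hvc, h0]
      · intro r hrd
        rw [hrc r hrd, hr' r (by omega), hr r hrd]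
    · have h1 := steps_jlt_of_not_lt (mem := mem) hj (hcond.not.mpr hlt)
      have h2 := ((hs.trans hs').trans h1).trans hse
      refine ⟨1 + (ne + (1 + (n' + n))), rege, ?_, h2.trans ?_, ?_, ?_⟩
      · simp only [compile, List.length_append, List.length_singleton]; omega
      · intro T
        rw [run, hjump]
        simp only [compile, List.length_append, List.length_singleton, ← add_assoc]
      · simp [eval, hlt, hve, h0]
      · intro r hrd
        rw [hre r hrd, hr' r (by omega), hr r hrd]

/-- The program that evaluates an expression and stops. -/
def Expr.prog (e : Expr) : Program := e.compile 1 0 ++ [.halt 1]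

theorem Expr.prog_answers {e : Expr} {T w : ℕ} {D : List Bool} {x : ℕ} {y : ℤ}
    (hT : e.prog.length ≤ T)
    (h : e.eval (memOf w D) (BitVec.ofNat w x) = BitVec.ofInt w y) :
    Answers e.prog T w D x y := by
  have hP : At e.prog 0 (e.compile 1 0 ++ [.halt 1]) := List.prefix_refl _
  obtain ⟨n, reg', hn, hs, hv, -⟩ := e.compile_steps e.prog (memOf w D) 1 0
    (Function.update (fun _ => 0) 0 (BitVec.ofNat w x)) one_pos hP.left
  have hlen : e.prog.length = (e.compile 1 0).length + 1 := by simp [prog]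
  refine run_mono (T := 1 + n) (by omega) ?_
  rw [hs 1, run, At.head hP.right]
  simp [hv, h]

/-! ### Bit strings -/

/-- The number whose binary digits are the `len` bits of `D` from position `p` on. -/
def rd (D : List Bool) (p len : ℕ) : ℕ := Nat.ofBits fun i : Fin len => D.getD (p + i) false

theorem testBit_rd (D : List Bool) (p len i : ℕ) :
    (rd D p len).testBit i = (decide (i < len) && D.getD (p + i) false) := by
  rw [rd, Nat.testBit_ofBits]
  split_ifs with h <;> simp [h]

theorem rd_lt (D : List Bool) (p len : ℕ) : rd D p len < 2 ^ len := Nat.ofBits_lt_two_pow _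

theorem rd_mod {D : List Bool} {p l len : ℕ} (h : l ≤ len) : rd D p len % 2 ^ l = rd D p l := by
  apply Nat.eq_of_testBit_eq
  intro i
  rw [Nat.testBit_mod_two_pow, testBit_rd, testBit_rd]
  by_cases hi : i < l
  · simp [hi, hi.trans_le h]
  · simp [hi]

theorem At.rd {D Y : List Bool} {p : ℕ} (h : At D p Y) {q len : ℕ} (hq : q + len ≤ Y.length) :
    rd D (p + q) len = FID.rd Y q len := by
  apply Nat.eq_of_testBit_eq
  intro i
  rw [testBit_rd, testBit_rd]
  by_cases hi : i < len
  · simp only [List.getD_eq_getElem?_getD, add_assoc]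
    rw [h.getElem? (by omega)]
  · simp [hi]

/-- The lowest `len` binary digits of `v`. -/
def bits (len v : ℕ) : List Bool := (List.range len).map v.testBit

@[simp] theorem length_bits (len v : ℕ) : (bits len v).length = len := by simp [bits]

theorem rd_bits {len v : ℕ} (hv : v < 2 ^ len) : rd (bits len v) 0 len = v := by
  apply Nat.eq_of_testBit_eq
  intro i
  rw [testBit_rd]
  by_cases hi : i < len
  · simp [hi, bits]
  · have : v.testBit i = false :=
      Nat.testBit_lt_two_pow (hv.trans_le (Nat.pow_le_pow_right two_pos (by omega)))
    simp [hi, this]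

theorem At.rd_bits {D : List Bool} {p len v : ℕ} (h : At D p (bits len v)) (hv : v < 2 ^ len) :
    FID.rd D p len = v := by
  have := h.rd (q := 0) (len := len) (by simp)
  rwa [FID.rd_bits hv, add_zero] at this

/-- The concatenation of `g 0, …, g (K - 1)`. -/
def cat {α : Type*} (K : ℕ) (g : ℕ → List α) : List α := (List.range K).flatMap g

theorem cat_succ {α : Type*} (K : ℕ) (g : ℕ → List α) : cat (K + 1) g = cat K g ++ g K := by
  simp [cat, List.range_succ]

theorem length_cat {α : Type*} (K : ℕ) (g : ℕ → List α) :
    (cat K g).length = ∑ i ∈ Finset.range K, (g i).length := by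
  induction K with
  | zero => simp [cat]
  | succ K ih => rw [cat_succ, List.length_append, ih, Finset.sum_range_succ]

theorem At.of_append_left {α : Type*} {X Y Z : List α} {p : ℕ} (h : At X p Z) :
    At (X ++ Y) p Z := by
  have h0 : At (X ++ Y) 0 X := List.prefix_append X Y
  simpa using h0.trans h

theorem At.append_right {α : Type*} (X Y : List α) : At (X ++ Y) X.length Y := by
  simp [At]

theorem at_cat {α : Type*} {K i : ℕ} (g : ℕ → List α) (hi : i < K) :
    At (cat K g) (∑ j ∈ Finset.range i, (g j).length) (g i) := by
  induction K with
  | zero => omega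
  | succ K ih =>
    rw [cat_succ]
    rcases Nat.lt_succ_iff_lt_or_eq.mp hi with h | rfl
    · exact (ih h).of_append_left
    · rw [← length_cat]
      exact At.append_right _ _

/-- The numbers `v 0, …, v (K - 1)` with `len` bits each. -/
def array (len K : ℕ) (v : ℕ → ℕ) : List Bool := cat K fun i => bits len (v i)

@[simp] theorem length_array (len K : ℕ) (v : ℕ → ℕ) : (array len K v).length = K * len := by
  simp [array, length_cat]

theorem at_array {len K i : ℕ} (v : ℕ → ℕ) (hi : i < K) :
    At (array len K v) (i * len) (bits len (v i)) := by
  simpa [array] using at_cat (fun i => bits len (v i)) hi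

/-- The number of `w`-bit words that are needed for a bit string. -/
def words (w : ℕ) (l : List Bool) : ℕ := (l.length + w - 1) / w

theorem length_le_words {w : ℕ} (hw : 0 < w) (l : List Bool) : l.length ≤ words w l * w := by
  have := Nat.lt_div_mul_add (a := l.length + w - 1) hw
  rw [words]
  omega

theorem words_mul_le (w : ℕ) (l : List Bool) : words w l * w ≤ l.length + w := by
  have := Nat.div_mul_le_self (l.length + w - 1) w
  rw [words]
  omega

theorem length_div_le_words (w : ℕ) (l : List Bool) : l.length / w ≤ words w l := by
  rcases Nat.eq_zero_or_pos w with rfl | hw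
  · simp
  · exact Nat.div_le_div_right (by omega)

/-- A bit string filled up with zeros to whole words. -/
def pad (w : ℕ) (l : List Bool) : List Bool :=
  l ++ List.replicate (words w l * w - l.length) false

theorem length_pad {w : ℕ} (hw : 0 < w) (l : List Bool) : (pad w l).length = words w l * w := by
  have := length_le_words hw l
  simp [pad]; omega

theorem at_pad (w : ℕ) (l : List Bool) : At (pad w l) 0 l := List.prefix_append _ _

theorem at_cat_pad {w K i : ℕ} (hw : 0 < w) (g : ℕ → List Bool) (hi : i < K) :
    At (cat K fun j => pad w (g j)) ((∑ j ∈ Finset.range i, words w (g j)) * w) (g i) := by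
  have := (at_cat (fun j => pad w (g j)) hi).trans (at_pad w (g i))
  simpa [length_pad hw, Finset.sum_mul] using this

theorem length_cat_pad {w : ℕ} (hw : 0 < w) (K : ℕ) (g : ℕ → List Bool) :
    (cat K fun j => pad w (g j)).length = (∑ j ∈ Finset.range K, words w (g j)) * w := by
  simp [length_cat, length_pad hw, Finset.sum_mul]

/-! ### Values of expressions -/

theorem toNat_memOf (w : ℕ) (D : List Bool) (j : ℕ) : (memOf w D j).toNat = rd D (j * w) w := by
  rw [memOf, BitVec.toNat_ofFnLE, rd]

instance : Add Expr := ⟨.op .add⟩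
instance : Sub Expr := ⟨.op .sub⟩
instance : Mul Expr := ⟨.op .mul⟩
instance : Div Expr := ⟨.op .div⟩
instance : Mod Expr := ⟨.op .mod⟩

/-- With the bit string `D` in memory and the argument `x`, the expression `e` has the value `n`. -/
def Ev (w : ℕ) (D : List Bool) (x : BitVec w) (e : Expr) (n : ℕ) : Prop :=
  (e.eval (memOf w D) x).toNat = n

section Ev

variable {w : ℕ} {D : List Bool} {x : BitVec w} {e e' : Expr} {a b : ℕ}

theorem Ev.lt (h : Ev w D x e a) : a < 2 ^ w := h ▸ BitVec.isLt _

theorem ev_const (h : a < 2 ^ w) : Ev w D x (.const a) a := by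
  simp [Ev, Expr.eval, Nat.mod_eq_of_lt h]

theorem Ev.add (h : Ev w D x e a) (h' : Ev w D x e' b) (hab : a + b < 2 ^ w) :
    Ev w D x (e + e') (a + b) := by
  subst h h'
  exact Nat.mod_eq_of_lt hab

theorem Ev.mul (h : Ev w D x e a) (h' : Ev w D x e' b) (hab : a * b < 2 ^ w) :
    Ev w D x (e * e') (a * b) := by
  subst h h'
  exact (BitVec.toNat_mul _ _).trans (Nat.mod_eq_of_lt hab)

theorem Ev.sub (h : Ev w D x e a) (h' : Ev w D x e' b) (hab : b ≤ a) :
    Ev w D x (e - e') (a - b) := by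
  subst h h'
  exact BitVec.toNat_sub_of_le hab

theorem Ev.div (h : Ev w D x e a) (h' : Ev w D x e' b) : Ev w D x (e / e') (a / b) := by
  subst h h'
  exact BitVec.toNat_udiv

theorem Ev.mod (h : Ev w D x e a) (h' : Ev w D x e' b) : Ev w D x (e % e') (a % b) := by
  subst h h'
  exact BitVec.toNat_umod

theorem Ev.load (h : Ev w D x e a) : Ev w D x (.load e) (rd D (a * w) w) := by
  subst h
  exact toNat_memOf _ _ _

theorem Ev.ite_pos {c d : Expr} {n : ℕ} (h : Ev w D x e a) (h' : Ev w D x e' b) (hab : a < b)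
    (hn : Ev w D x c n) : Ev w D x (.ite e e' c d) n := by
  subst h h'
  simpa only [Ev, Expr.eval, hab, if_true] using hn

theorem Ev.ite_neg {c d : Expr} {n : ℕ} (h : Ev w D x e a) (h' : Ev w D x e' b) (hab : ¬ a < b)
    (hn : Ev w D x d n) : Ev w D x (.ite e e' c d) n := by
  subst h h'
  simpa only [Ev, Expr.eval, hab, if_false] using hn

end Ev

theorem eval_neg_one {w : ℕ} {D : List Bool} {x : BitVec w} :
    (Expr.const 0 - Expr.const 1).eval (memOf w D) x = BitVec.ofInt w (-1) := by
  change BitVec.ofNat w 0 - BitVec.ofNat w 1 = BitVec.ofInt w (-1)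
  rw [BitVec.ofInt_neg]
  simp

/-- The word size, the block length and the length of short fields are in the memory words
`1`, `2` and `3`. -/
def wE : Expr := .load (.const 1)

def powE (e : Expr) : Expr := .op .shl (.const 1) e

theorem Ev.pow {w : ℕ} {D : List Bool} {x : BitVec w} {e : Expr} {a : ℕ} (h : Ev w D x e a)
    (ha : a < w) : Ev w D x (powE e) (2 ^ a) := by
  subst h
  have h1 : 1 % 2 ^ w = 1 := Nat.mod_eq_of_lt (Nat.one_lt_two_pow (by omega))
  simp only [Ev, powE, Expr.eval, BinOp.eval, BitVec.shiftLeft_eq', BitVec.toNat_shiftLeft,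
    BitVec.toNat_ofNat, h1, Nat.shiftLeft_eq, one_mul]
  exact Nat.mod_eq_of_lt (Nat.pow_lt_pow_right (by norm_num) ha)

/-- The number in the `len` bits from position `p` on, counted from the beginning of the word with
address `base`. -/
def rdE (base p len : Expr) : Expr :=
  .op .or (.op .shr (.load (base + p / wE)) (p % wE))
    (.op .shl (.load (base + p / wE + .const 1)) (wE - p % wE)) % powE len

/-- A field shorter than a word touches at most two consecutive words; their shifts are joined by
`or`, and `mod` removes the bits above the field. If `q % w = 0`, the second word is shifted by `w`
and vanishes. It is loaded in any case, so its address has to fit into a word. `l < w` makes `2 ^ l`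
representable. -/
theorem ev_rdE {w : ℕ} {D : List Bool} {x : BitVec w} {base p len : Expr} {a q l : ℕ}
    (hw : Ev w D x wE w) (ha : Ev w D x base a) (hp : Ev w D x p q) (hl : Ev w D x len l)
    (hlw : l < w) (hq : a + q / w + 1 < 2 ^ w) :
    Ev w D x (rdE base p len) (rd D (a * w + q) l) := by
  have hw0 : 0 < w := by omega
  have h1 : Ev w D x (base + p / wE) (a + q / w) := ha.add (hp.div hw) (by omega)
  have h2 : Ev w D x (base + p / wE + .const 1) (a + q / w + 1) :=
    h1.add (ev_const (Nat.one_lt_two_pow (by omega))) hq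
  have h3 : Ev w D x (p % wE) (q % w) := hp.mod hw
  have hlt := Nat.mod_lt q hw0
  have h4 : Ev w D x (wE - p % wE) (w - q % w) := hw.sub h3 hlt.le
  have hor : Ev w D x (.op .or (.op .shr (.load (base + p / wE)) (p % wE))
      (.op .shl (.load (base + p / wE + .const 1)) (wE - p % wE))) (rd D (a * w + q) w) := by
    have h5 := h1.load
    have h6 := h2.load
    unfold Ev at h3 h4 h5 h6 ⊢
    simp only [Expr.eval, BinOp.eval, BitVec.shiftLeft_eq', BitVec.ushiftRight_eq',
      BitVec.toNat_or, BitVec.toNat_ushiftRight, BitVec.toNat_shiftLeft] at h3 h4 h5 h6 ⊢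
    rw [h3, h4, h5, h6]
    apply Nat.eq_of_testBit_eq
    intro i
    have hqd := Nat.div_add_mod q w
    rw [Nat.testBit_or, Nat.testBit_shiftRight, Nat.testBit_mod_two_pow, Nat.testBit_shiftLeft,
      testBit_rd, testBit_rd, testBit_rd]
    have e1 : (a + q / w) * w + (q % w + i) = a * w + q + i := by
      rw [add_mul, mul_comm (q / w)]; omega
    by_cases hi : i < w
    · by_cases hi' : q % w + i < w
      · have : ¬ (w - q % w ≤ i) := by omega
        simp [hi, hi', this, e1]
      · have h' : w - q % w ≤ i := by omega
        have e2 : (a + q / w + 1) * w + (i - (w - q % w)) = a * w + q + i := by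
          rw [add_mul, add_mul, mul_comm (q / w)]; omega
        have e3 : i - (w - q % w) < w := by omega
        simp only [hi, hi', h', e1, e2, e3, decide_true, decide_false, Bool.true_and,
          Bool.false_and, Bool.false_or]
    · have : ¬ (q % w + i < w) := by omega
      simp [hi, this]
  have := hor.mod (hl.pow hlw)
  rwa [rd_mod hlw.le] at this

/-! ### Sections of the memory -/

def tE : Expr := .load (.const 2)
def fE : Expr := .load (.const 3)

/-- The address of section `k` is in memory word `4 + k`. -/
def secE (k : ℕ) : Expr := .load (.const (4 + k))

/-- The first memory words hold the parameters, which are in the range that the data structure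
needs. -/
structure Setup (w t f : ℕ) (D : List Bool) : Prop where
  rd_w : rd D (1 * w) w = w
  rd_t : rd D (2 * w) w = t
  rd_f : rd D (3 * w) w = f
  t_le : 8 * t ≤ w
  le_t : 100 ≤ t
  f_le : f ≤ t
  pow_t : t ^ 4 ≤ 2 ^ f

/-- Section `k` of the memory begins with the bit string `Y`. -/
def Sec (w : ℕ) (D : List Bool) (k : ℕ) (Y : List Bool) : Prop :=
  k < 60 ∧ ∃ a, rd D ((4 + k) * w) w = a ∧ At D (a * w) Y ∧ a + Y.length / w + 1 < 2 ^ w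

section Sections

variable {w t f : ℕ} {D : List Bool} {x : BitVec w}

theorem Setup.lt_two_pow (h : Setup w t f D) {k : ℕ} (hk : k < 64) : k < 2 ^ w := by
  have h1 := h.t_le
  have h2 := h.le_t
  calc k < 2 ^ 6 := hk
    _ ≤ 2 ^ w := Nat.pow_le_pow_right two_pos (by omega)

theorem Setup.ev_wE (h : Setup w t f D) : Ev w D x wE w := by
  have := (ev_const (D := D) (x := x) (h.lt_two_pow (k := 1) (by norm_num))).load
  rwa [h.rd_w] at this

theorem Setup.ev_tE (h : Setup w t f D) : Ev w D x tE t := by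
  have := (ev_const (D := D) (x := x) (h.lt_two_pow (k := 2) (by norm_num))).load
  rwa [h.rd_t] at this

theorem Setup.ev_fE (h : Setup w t f D) : Ev w D x fE f := by
  have := (ev_const (D := D) (x := x) (h.lt_two_pow (k := 3) (by norm_num))).load
  rwa [h.rd_f] at this

theorem Setup.ev_secE (h : Setup w t f D) {k : ℕ} {Y : List Bool} (hs : Sec w D k Y) :
    ∃ a, Ev w D x (secE k) a ∧ At D (a * w) Y ∧ a + Y.length / w + 1 < 2 ^ w := by
  obtain ⟨hk, a, ha, hY, hlt⟩ := hs
  have := (ev_const (D := D) (x := x) (h.lt_two_pow (k := 4 + k) (by omega))).load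
  rw [ha] at this
  exact ⟨a, this, hY, hlt⟩

theorem Setup.f_lt_w (h : Setup w t f D) : f < w := by
  have h1 := h.t_le; have h2 := h.le_t; have h3 := h.f_le; omega

theorem ev_load_bits {e : Expr} {a v : ℕ} (he : Ev w D x e a) (h : At D (a * w) (bits w v))
    (hv : v < 2 ^ w) : Ev w D x (.load e) v := by
  have := he.load
  rwa [h.rd_bits hv] at this

theorem ev_rdE_bits (hs : Setup w t f D) {base p len : Expr} {a q l v : ℕ}
    (ha : Ev w D x base a) (hp : Ev w D x p q) (hl : Ev w D x len l)
    (hlw : l < w) (hq : a + q / w + 1 < 2 ^ w) (h : At D (a * w + q) (bits l v))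
    (hv : v < 2 ^ l) : Ev w D x (rdE base p len) v := by
  have := ev_rdE hs.ev_wE ha hp hl hlw hq
  rwa [h.rd_bits hv] at this

/-- Entry `i` of the array of words in section `k`. -/
def wordE (k : ℕ) (i : Expr) : Expr := .load (secE k + i)

theorem Setup.ev_wordE (hs : Setup w t f D) {k K I : ℕ} {v : ℕ → ℕ} {i : Expr}
    (hk : Sec w D k (array w K v)) (hi : Ev w D x i I) (hI : I < K) (hv : v I < 2 ^ w) :
    Ev w D x (wordE k i) (v I) := by
  obtain ⟨a, ha, hY, hlt⟩ := hs.ev_secE (x := x) hk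
  have hw : 0 < w := by have := hs.f_lt_w; omega
  rw [length_array, Nat.mul_div_cancel _ hw] at hlt
  refine ev_load_bits (ha.add hi (by omega)) ?_ hv
  rw [add_mul]
  exact hY.trans (at_array v hI)

/-- Entry `i` of the array of short fields in section `k`. -/
def fieldE (k : ℕ) (i : Expr) : Expr := rdE (secE k) (i * fE) fE

theorem Setup.ev_fieldE (hs : Setup w t f D) {k K I : ℕ} {v : ℕ → ℕ} {i : Expr}
    (hk : Sec w D k (array f K v)) (hi : Ev w D x i I) (hI : I < K) (hv : v I < 2 ^ f)
    (hK : K * f < 2 ^ w) : Ev w D x (fieldE k i) (v I) := by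
  obtain ⟨a, ha, hY, hlt⟩ := hs.ev_secE (x := x) hk
  rw [length_array] at hlt
  have hle : I * f ≤ K * f := Nat.mul_le_mul_right _ hI.le
  have hle' : I * f / w ≤ K * f / w := Nat.div_le_div_right hle
  exact ev_rdE_bits hs ha (hi.mul hs.ev_fE (by omega)) hs.ev_fE hs.f_lt_w (by omega)
    (hY.trans (at_array v hI)) hv

/-! ### Sequences with small increments -/

/-- Entry `i` of a sequence with small increments: every `t`-th entry is a word in section `k`,
the differences are fields in section `k'`. -/
def stepE (k k' : ℕ) (i : Expr) : Expr := wordE k (i / tE) + fieldE k' i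

def stepWords (w t M : ℕ) (v : ℕ → ℕ) : List Bool := array w (M / t + 1) fun g => v (g * t)

def stepFields (t f M : ℕ) (v : ℕ → ℕ) : List Bool := array f M fun b => v b - v (b / t * t)

/-- Fewer than `t` steps of size at most `t` separate an entry from the preceding sample, so the
difference is below `t * t` and fits into a field by `t ^ 4 ≤ 2 ^ f`. -/
theorem Setup.ev_stepE (hs : Setup w t f D) {k k' M I : ℕ} {v : ℕ → ℕ} {i : Expr}
    (hk : Sec w D k (stepWords w t M v)) (hk' : Sec w D k' (stepFields t f M v))
    (hmono : Monotone v) (hstep : ∀ b, v (b + 1) ≤ v b + t)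
    (hi : Ev w D x i I) (hI : I < M) (hv : v I < 2 ^ w)
    (hM : M * f < 2 ^ w) : Ev w D x (stepE k k' i) (v I) := by
  have ht : 0 < t := by have := hs.le_t; omega
  have hle : I / t * t ≤ I := Nat.div_mul_le_self I t
  have hvle : v (I / t * t) ≤ v I := hmono hle
  have hinc : ∀ c b, v (b + c) ≤ v b + c * t := by
    intro c
    induction c with
    | zero => simp
    | succ c ih =>
      intro b
      have h1 := hstep (b + c)
      have h2 := ih b
      rw [← add_assoc, add_mul, one_mul]
      omega
  have hd : v I - v (I / t * t) < 2 ^ f := by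
    have h1 := hinc (I % t) (I / t * t)
    rw [Nat.div_add_mod'] at h1
    have h2 : I % t < t := Nat.mod_lt _ ht
    have h3 : I % t * t < t ^ 4 := by
      have : I % t * t < t * t := Nat.mul_lt_mul_of_pos_right h2 ht
      nlinarith [Nat.one_le_pow 2 t ht]
    have := hs.pow_t
    omega
  have h1 := hs.ev_wordE hk (hi.div hs.ev_tE)
    (Nat.lt_succ_of_le (Nat.div_le_div_right hI.le)) (hvle.trans_lt hv)
  have h2 := hs.ev_fieldE hk' hi hI hd hM
  have h3 := h1.add h2 (by rwa [Nat.add_sub_cancel' hvle])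
  rwa [Nat.add_sub_cancel' hvle] at h3

end Sections

/-! ### Numbering the elements of a finite set -/

/-- An arbitrary numbering suffices: the tables that decode it are part of the stored string, so
they only have to exist. -/
noncomputable def encode {α : Type*} [DecidableEq α] (F : Finset α) (a : α) : ℕ :=
  if h : a ∈ F then F.equivFin ⟨a, h⟩ else 0

/-- The default value only fills table entries that no query reads. -/
noncomputable def decode {α : Type*} [Inhabited α] (F : Finset α) (n : ℕ) : α :=
  if h : n < F.card then F.equivFin.symm ⟨n, h⟩ else default

theorem encode_lt {α : Type*} [DecidableEq α] {F : Finset α} {a : α} (h : a ∈ F) :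
    encode F a < F.card := by
  simp [encode, h]

theorem decode_encode {α : Type*} [DecidableEq α] [Inhabited α] {F : Finset α} {a : α}
    (h : a ∈ F) : decode F (encode F a) = a := by
  rw [decode, dif_pos (encode_lt h)]
  simp [encode, h]

/-! ### Codes for short monotone sequences -/

/-- The monotone sequences of length `t` with values at most `s`. -/
def monoSeqs (t s : ℕ) : Finset (Fin t → Fin (s + 1)) :=
  open Classical in Finset.univ.filter Monotone

/-- A monotone sequence is determined by the number of its values that are at most `r`, for each `r
< s`, and each number has `t + 1` possibilities. This bound lets the code length be charged to the
span `s`. -/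
theorem card_monoSeqs_le_pow (t s : ℕ) : (monoSeqs t s).card ≤ (t + 1) ^ s := by
  classical
  have : (monoSeqs t s).card ≤ (Finset.univ : Finset (Fin s → Fin (t + 1))).card := by
    refine Finset.card_le_card_of_injOn
      (fun d r => ⟨(Finset.univ.filter fun i => (d i : ℕ) ≤ r).card,
        Nat.lt_succ_of_le ((Finset.card_filter_le _ _).trans (by simp))⟩) (by simp) ?_
    intro d hd d' hd' hdd
    have hmono : Monotone d := by simpa [monoSeqs] using hd
    have hmono' : Monotone d' := by simpa [monoSeqs] using hd'
    have key : ∀ (d d' : Fin t → Fin (s + 1)), Monotone d → Monotone d' →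
        (∀ r : Fin s, (Finset.univ.filter fun i => (d i : ℕ) ≤ r).card =
          (Finset.univ.filter fun i => (d' i : ℕ) ≤ r).card) → ∀ i, (d i : ℕ) ≤ d' i := by
      intro d d' hd hd' h i
      by_contra! hlt
      have hr : (d' i : ℕ) < s := by have := (d i).isLt; omega
      have h0 := h ⟨d' i, hr⟩
      -- At the threshold `d' i` the index `i` is counted for `d'` but not for `d`, and by
      -- monotonicity every index counted for `d` precedes `i`.
      have hsub : (Finset.univ.filter fun j => (d j : ℕ) ≤ d' i) ⊂
          (Finset.univ.filter fun j => (d' j : ℕ) ≤ d' i) := by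
        rw [Finset.ssubset_iff_of_subset]
        · refine ⟨i, by simp, by simpa using hlt⟩
        · intro j hj
          simp only [Finset.mem_filter, Finset.mem_univ, true_and] at hj ⊢
          have hji : j ≤ i := by
            by_contra! hij
            have := hd hij.le
            rw [Fin.le_def] at this
            omega
          exact hd' hji
      have := Finset.card_lt_card hsub
      simp only at h0
      omega
    have heq : ∀ r : Fin s, (Finset.univ.filter fun i => (d i : ℕ) ≤ r).card =
          (Finset.univ.filter fun i => (d' i : ℕ) ≤ r).card := by
      intro r
      have := congrFun hdd r
      simpa using this
    funext i
    exact Fin.ext (le_antisymm (key d d' hmono hmono' heq i)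
      (key d' d hmono' hmono (fun r => (heq r).symm) i))
  simpa using this

/-- Adding the index makes the sequence strictly increasing, hence determined by its set of values,
a subset of `[t + s]`. For `s < t` this bounds the number of bits a table lookup needs. -/
theorem card_monoSeqs_le_two_pow (t s : ℕ) : (monoSeqs t s).card ≤ 2 ^ (t + s) := by
  classical
  have : (monoSeqs t s).card ≤ (Finset.range (t + s)).powerset.card := by
    refine Finset.card_le_card_of_injOn
      (fun d => Finset.univ.image fun i : Fin t => (i : ℕ) + d i) ?_ ?_
    · intro d _
      simp only [Finset.coe_powerset, Set.mem_preimage, Set.mem_powerset_iff]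
      intro y hy
      simp only [Finset.coe_image, Finset.coe_univ, Set.image_univ, Set.mem_range] at hy
      obtain ⟨i, rfl⟩ := hy
      have := (d i).isLt
      have := i.isLt
      simp only [Finset.coe_range, Set.mem_Iio]
      omega
    · intro d hd d' hd' hdd
      have hmono : Monotone d := by simpa [monoSeqs] using hd
      have hmono' : Monotone d' := by simpa [monoSeqs] using hd'
      have hs : ∀ e : Fin t → Fin (s + 1), Monotone e →
          StrictMono fun i : Fin t => (i : ℕ) + e i := by
        intro e he i j hij
        have := he hij.le
        rw [Fin.le_def] at this
        rw [Fin.lt_def] at hij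
        simp only
        omega
      have hr : Set.range (fun i : Fin t => (i : ℕ) + d i) =
          Set.range (fun i : Fin t => (i : ℕ) + d' i) := by
        have := congrArg (fun F : Finset ℕ => (F : Set ℕ)) hdd
        simpa using this
      have := (StrictMono.range_inj (hs d hmono) (hs d' hmono')).mp hr
      funext i
      have h := congrFun this i
      exact Fin.ext (by simpa using h)
  simpa using this

/-- The number of bits of the code of a monotone sequence. -/
def monoLen (t f s : ℕ) : ℕ := min (s * f) (t + s)

noncomputable def monoCode (t s : ℕ) (d : ℕ → ℕ) : ℕ :=
  encode (monoSeqs t s) fun i => Fin.ofNat (s + 1) (d i)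

noncomputable def monoDecode (t s n i : ℕ) : ℕ :=
  if h : i < t then decode (monoSeqs t s) n ⟨i, h⟩ else 0

theorem mem_monoSeqs {t s : ℕ} {d : ℕ → ℕ} (hd : Monotone d) (hs : ∀ i < t, d i ≤ s) :
    (fun i : Fin t => Fin.ofNat (s + 1) (d i)) ∈ monoSeqs t s := by
  simp only [monoSeqs, Finset.mem_filter, Finset.mem_univ, true_and]
  intro i j hij
  have h1 := hs i i.isLt
  have h2 := hs j j.isLt
  simp only [Fin.le_def, Fin.ofNat]
  rw [Nat.mod_eq_of_lt (by omega), Nat.mod_eq_of_lt (by omega)]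
  exact hd hij

theorem monoCode_lt {t f s : ℕ} {d : ℕ → ℕ} (hd : Monotone d) (hs : ∀ i < t, d i ≤ s)
    (ht : t + 1 ≤ 2 ^ f) : monoCode t s d < 2 ^ monoLen t f s := by
  refine (encode_lt (mem_monoSeqs hd hs)).trans_le ?_
  rcases min_cases (s * f) (t + s) with ⟨h, -⟩ | ⟨h, -⟩
  · rw [monoLen, h, mul_comm, pow_mul]
    exact (card_monoSeqs_le_pow t s).trans (Nat.pow_le_pow_left ht s)
  · rw [monoLen, h]
    exact card_monoSeqs_le_two_pow t s

theorem monoDecode_monoCode {t s : ℕ} {d : ℕ → ℕ} (hd : Monotone d) (hs : ∀ i < t, d i ≤ s)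
    {i : ℕ} (hi : i < t) : monoDecode t s (monoCode t s d) i = d i := by
  rw [monoDecode, dif_pos hi, monoCode, decode_encode (mem_monoSeqs hd hs)]
  have := hs i hi
  simp only [Fin.ofNat]
  exact Nat.mod_eq_of_lt (by omega)

/-! ### Access to a monotone sequence -/

section Mono

variable (w t f : ℕ) (β : ℕ → ℕ)

/-- The values in subgroup `J`, relative to the first one. -/
def subVal (J s : ℕ) : ℕ := β (J * t + s) - β (J * t)

/-- Measured up to the first value of the next subgroup, so that spans of consecutive subgroups
telescope; likewise for groups below. -/
def subSpan (J : ℕ) : ℕ := β (J * t + t) - β (J * t)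

/-- A subgroup of `t` values: explicit if the values differ much, coded otherwise. -/
noncomputable def subBits (J : ℕ) : List Bool :=
  if subSpan t β J < t then
    bits (monoLen t f (subSpan t β J)) (monoCode t (subSpan t β J) (subVal t β J))
  else array f t (subVal t β J)

def groupSpan (g : ℕ) : ℕ := β ((g * t + t) * t) - β (g * t * t)

/-- The directory of a dense group: for each of its subgroups the first value, the position of
the subgroup and the span. -/
noncomputable def groupDir (g a : ℕ) : ℕ :=
  if a < t then β ((g * t + a) * t) - β (g * t * t)
  else if a < 2 * t then
    3 * t * f + ∑ j ∈ Finset.range (a - t), (subBits t f β (g * t + j)).length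
  else subSpan t β (g * t + (a - 2 * t))

noncomputable def denseBits (g : ℕ) : List Bool :=
  array f (3 * t) (groupDir t f β g) ++ cat t fun j => subBits t f β (g * t + j)

/-- A group of `t * t` values: one word for each value if the values differ much. -/
noncomputable def groupBits (g : ℕ) : List Bool :=
  if t ^ 3 ≤ groupSpan t β g then array w (t * t) fun i => β (g * t * t + i)
  else denseBits t f β g

def groupFirst (G : ℕ) : List Bool := array w G fun g => β (g * t * t)

def groupFlag (G : ℕ) : List Bool := array w G fun g => if t ^ 3 ≤ groupSpan t β g then 1 else 0

noncomputable def groupPtr (G : ℕ) : List Bool :=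
  array w G fun g => ∑ g' ∈ Finset.range g, words w (groupBits w t f β g')

noncomputable def groupData (G : ℕ) : List Bool := cat G fun g => pad w (groupBits w t f β g)

/-- An index packs a span, `2 * t` bits read from the memory, and a position in the subgroup. The
reduction modulo `2 ^ monoLen` drops the bits that were read beyond the end of the code. -/
noncomputable def monoTable : List Bool :=
  array w (t * 2 ^ (2 * t) * t) fun I =>
    monoDecode t (I / t / 2 ^ (2 * t)) (I / t % 2 ^ (2 * t) % 2 ^ monoLen t f (I / t / 2 ^ (2 * t)))
      (I % t)

end Mono

/-- Entry `i` of a monotone sequence that is stored in sections `k, …, k + 4`. -/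
def monoE (k : ℕ) (i : Expr) : Expr :=
  let g := i / (tE * tE)
  let r := i % (tE * tE)
  let base := secE (k + 3) + wordE (k + 2) g
  let entry (a : Expr) := rdE base (a * fE) fE
  let j := r / tE
  let s := r % tE
  let ptr := entry (tE + j)
  let span := entry (tE + tE + j)
  .ite (.const 0) (wordE (k + 1) g) (.load (base + r))
    (wordE k g + entry j +
      .ite span tE
        (wordE (k + 4) ((span * powE (tE + tE) + rdE base ptr (tE + tE)) * tE + s))
        (rdE base (ptr + s * fE) fE))

/-! ### Correctness and size of the structure for monotone sequences. -/

section MonoLemmas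

variable {w t f : ℕ} {β : ℕ → ℕ} {D : List Bool} {x : BitVec w}

theorem subVal_mono (hβ : Monotone β) (J : ℕ) : Monotone (subVal t β J) := fun _ _ h =>
  Nat.sub_le_sub_right (hβ (Nat.add_le_add_left h _)) _

theorem subVal_le (hβ : Monotone β) (J : ℕ) {s : ℕ} (hs : s < t) :
    subVal t β J s ≤ subSpan t β J :=
  Nat.sub_le_sub_right (hβ (Nat.add_le_add_left hs.le _)) _

theorem length_subBits_le_mul (J : ℕ) :
    (subBits t f β J).length ≤ subSpan t β J * f := by
  rw [subBits]
  split_ifs with h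
  · rw [length_bits, monoLen]
    exact min_le_left _ _
  · rw [length_array]
    exact Nat.mul_le_mul_right _ (not_lt.mp h)

theorem length_subBits_le (hf : 2 ≤ f) (J : ℕ) : (subBits t f β J).length ≤ t * f := by
  rw [subBits]
  split_ifs with h
  · rw [length_bits, monoLen]
    refine (min_le_right _ _).trans ?_
    nlinarith
  · rw [length_array]

theorem sum_subSpan (hβ : Monotone β) (g n : ℕ) :
    ∑ j ∈ Finset.range n, subSpan t β (g * t + j) = β ((g * t + n) * t) - β (g * t * t) := by
  induction n with
  | zero => simp
  | succ n ih =>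
    rw [Finset.sum_range_succ, ih, subSpan]
    have h1 : β (g * t * t) ≤ β ((g * t + n) * t) := hβ (Nat.mul_le_mul_right _ (by omega))
    have e : (g * t + n) * t + t = (g * t + (n + 1)) * t := by ring
    have h2 : β ((g * t + n) * t) ≤ β ((g * t + n) * t + t) := hβ (by omega)
    rw [e] at h2 ⊢
    omega

theorem length_denseBits_le (hβ : Monotone β) (g : ℕ) :
    (denseBits t f β g).length ≤ 3 * t * f + groupSpan t β g * f := by
  rw [denseBits, List.length_append, length_array, length_cat]
  refine Nat.add_le_add_left ?_ _
  refine (Finset.sum_le_sum fun j _ => length_subBits_le_mul (f := f) _).trans ?_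
  rw [← Finset.sum_mul, sum_subSpan hβ, groupSpan]

theorem sum_length_subBits_le (hf : 2 ≤ f) (g n : ℕ) :
    ∑ j ∈ Finset.range n, (subBits t f β (g * t + j)).length ≤ n * (t * f) := by
  have := Finset.sum_le_sum fun j (_ : j ∈ Finset.range n) =>
    length_subBits_le (t := t) (β := β) hf (g * t + j)
  simpa using this

/-- A sparse group uses `t * t * w` bits against a span of at least `t ^ 3`, that is `w / t` bits
per unit of span. Multiplying by `t` avoids the division. -/
theorem mul_length_groupBits_le (hβ : Monotone β) (g : ℕ) :
    t * (groupBits w t f β g).length ≤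
      t * (3 * t * f + groupSpan t β g * f) + groupSpan t β g * w := by
  rw [groupBits]
  split_ifs with h
  · rw [length_array]
    have : t * (t * t * w) = t ^ 3 * w := by ring
    rw [this]
    exact (Nat.mul_le_mul_right w h).trans (Nat.le_add_left _ _)
  · exact (Nat.mul_le_mul_left t (length_denseBits_le hβ g)).trans (Nat.le_add_right _ _)

theorem Setup.two_le_f (hs : Setup w t f D) : 2 ≤ f := by
  by_contra! h
  have h1 := hs.pow_t
  have h2 := hs.le_t
  have h3 : 2 ^ f ≤ 2 ^ 1 := Nat.pow_le_pow_right two_pos (by omega)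
  have h4 : t ≤ t ^ 4 := Nat.le_self_pow (by norm_num) t
  omega

theorem Setup.sq_lt (hs : Setup w t f D) : t * t < 2 ^ w := by
  have h1 := hs.pow_t
  have h2 := hs.le_t
  have h3 : 2 ^ f < 2 ^ w := Nat.pow_lt_pow_right (by norm_num) hs.f_lt_w
  have : t * t ≤ t ^ 4 := by nlinarith [Nat.one_le_pow 2 t (by omega)]
  omega

/-- Relative values and spans in a dense group are below `t ^ 3`, and bit positions are at most `3 *
t * t + t ^ 3 < t ^ 4`. -/
theorem groupDir_lt (hs : Setup w t f D) (hβ : Monotone β) {g a : ℕ}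
    (hg : groupSpan t β g < t ^ 3) (ha : a < 3 * t) : groupDir t f β g a < 2 ^ f := by
  have hf := hs.two_le_f
  have h1 := hs.pow_t
  have h2 := hs.le_t
  have h3 := hs.f_le
  have h34 : t ^ 3 ≤ t ^ 4 := Nat.pow_le_pow_right (by omega) (by norm_num)
  rw [groupDir]
  split_ifs with hat hat'
  · have : β ((g * t + a) * t) ≤ β ((g * t + t) * t) := hβ (Nat.mul_le_mul_right _ (by omega))
    rw [groupSpan] at hg
    omega
  · have h4 := sum_length_subBits_le (t := t) (β := β) hf g (a - t)
    have h5 : (a - t) * (t * f) ≤ t * (t * t) :=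
      Nat.mul_le_mul (by omega) (Nat.mul_le_mul_left _ h3)
    have h6 : 3 * t * f ≤ 3 * t * t := Nat.mul_le_mul_left _ h3
    have h7 : 3 * t * t + t * (t * t) < t ^ 4 := by
      have : 3 * t * t ≤ t * (t * t) := by
        rw [mul_assoc]; exact Nat.mul_le_mul_right _ (by omega)
      have e : t ^ 4 = t * (t * (t * t)) := by ring
      have : 100 * (t * (t * t)) ≤ t * (t * (t * t)) := Nat.mul_le_mul_right _ h2
      have : 0 < t * (t * t) := by positivity
      omega
    omega
  · have h4 : subSpan t β (g * t + (a - 2 * t)) ≤ groupSpan t β g := by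
      rw [subSpan, groupSpan]
      have e : (g * t + (a - 2 * t)) * t + t = (g * t + (a - 2 * t + 1)) * t := by ring
      have h5 : β ((g * t + (a - 2 * t)) * t + t) ≤ β ((g * t + t) * t) := by
        rw [e]
        exact hβ (Nat.mul_le_mul_right _ (by omega))
      have h6 : β (g * t * t) ≤ β ((g * t + (a - 2 * t)) * t) :=
        hβ (Nat.mul_le_mul_right _ (by omega))
      omega
    omega

theorem Setup.ev_monoE (hs : Setup w t f D) (hβ : Monotone β) {k G : ℕ}
    (h0 : Sec w D k (groupFirst w t β G)) (h1 : Sec w D (k + 1) (groupFlag w t β G))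
    (h2 : Sec w D (k + 2) (groupPtr w t f β G)) (h3 : Sec w D (k + 3) (groupData w t f β G))
    (h4 : Sec w D (k + 4) (monoTable w t f))
    {i : Expr} {I : ℕ} (hi : Ev w D x i I) (hI : I < G * t * t) (hlt : β I < 2 ^ w) :
    Ev w D x (monoE k i) (β I) := by
  have ht := hs.le_t
  have ht0 : 0 < t := by omega
  have hw0 : 0 < w := by have := hs.f_lt_w; omega
  have hf := hs.two_le_f
  have hfw := hs.f_lt_w
  have htt := hs.ev_tE (x := x) |>.mul hs.ev_tE hs.sq_lt
  have hgI := hi.div htt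
  have hrI := hi.mod htt
  have hrlt : I % (t * t) < t * t := Nat.mod_lt _ (by positivity)
  have hIgr : I / (t * t) * t * t + I % (t * t) = I := by
    rw [mul_assoc]; exact Nat.div_add_mod' I (t * t)
  have hgG : I / (t * t) < G := by
    rw [Nat.div_lt_iff_lt_mul (by positivity), ← mul_assoc]; exact hI
  simp only [monoE]
  set g := I / (t * t)
  set r := I % (t * t)
  clear_value g r
  obtain ⟨a, ha, hY, hlen⟩ := hs.ev_secE (x := x) h3
  have hdata : (groupData w t f β G).length / w =
      ∑ g' ∈ Finset.range G, words w (groupBits w t f β g') := by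
    rw [groupData, length_cat_pad hw0, Nat.mul_div_cancel _ hw0]
  rw [hdata] at hlen
  have hptrle : (∑ g' ∈ Finset.range g, words w (groupBits w t f β g')) +
      words w (groupBits w t f β g) ≤ ∑ g' ∈ Finset.range G, words w (groupBits w t f β g') := by
    rw [← Finset.sum_range_succ]
    exact Finset.sum_le_sum_of_subset (Finset.range_mono hgG)
  have hptr := hs.ev_wordE h2 hgI hgG (by omega)
  have hbase := ha.add hptr (by omega)
  have hat := hY.trans (at_cat_pad hw0 (fun g => groupBits w t f β g) hgG)
  rw [← add_mul] at hat
  set A := a + ∑ g' ∈ Finset.range g, words w (groupBits w t f β g') with hA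
  have hAlt : A + words w (groupBits w t f β g) + 1 < 2 ^ w := by omega
  have hflag := hs.ev_wordE h1 hgI hgG (by
    have := hs.lt_two_pow (k := 1) (by norm_num)
    split_ifs <;> omega)
  have hc0 : Ev w D x (.const 0) 0 := ev_const (by positivity)
  have hfirst : β (g * t * t) ≤ β I := hβ (by omega)
  by_cases hsp : t ^ 3 ≤ groupSpan t β g
  · rw [if_pos hsp] at hflag
    refine Ev.ite_pos hc0 hflag one_pos ?_
    rw [groupBits, if_pos hsp] at hat hAlt
    have hwords := length_div_le_words w (array w (t * t) fun i => β (g * t * t + i))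
    rw [length_array, Nat.mul_div_cancel _ hw0] at hwords
    refine ev_load_bits (hbase.add hrI (by omega)) ?_ hlt
    have := hat.trans (at_array (fun i => β (g * t * t + i)) hrlt)
    rwa [hIgr, ← add_mul] at this
  · rw [if_neg hsp] at hflag
    refine Ev.ite_neg hc0 hflag (lt_irrefl 0) ?_
    rw [groupBits, if_neg hsp] at hat hAlt
    have hwords := length_div_le_words w (denseBits t f β g)
    have hbound : ∀ q ≤ (denseBits t f β g).length, A + q / w + 1 < 2 ^ w := by
      intro q hq
      have := Nat.div_le_div_right (c := w) hq
      omega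
    -- Bit offsets inside the group are computed by the program and must not overflow.
    have hsmall : (denseBits t f β g).length < 2 ^ w := by
      have h5 := length_denseBits_le (t := t) (f := f) hβ g
      have h6 : groupSpan t β g * f ≤ t ^ 3 * t := Nat.mul_le_mul (by omega) hs.f_le
      have h7 : 3 * t * f ≤ t ^ 3 * t := by
        refine Nat.mul_le_mul ?_ hs.f_le
        nlinarith
      have h8 : t ^ 3 * t ≤ 2 ^ f := by rw [← pow_succ]; exact hs.pow_t
      have h9 : 2 ^ (f + 2) ≤ 2 ^ w := Nat.pow_le_pow_right two_pos (by
        have := hs.t_le; have := hs.f_le; omega)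
      rw [pow_add] at h9
      omega
    have hdir : ∀ {e : Expr} {q : ℕ}, Ev w D x e q → q < 3 * t →
        Ev w D x (rdE (secE (k + 3) + wordE (k + 2) (i / (tE * tE))) (e * fE) fE)
          (groupDir t f β g q) := by
      intro e q he hq
      have hle : q * f ≤ (denseBits t f β g).length := by
        rw [denseBits, List.length_append, length_array]
        exact (Nat.mul_le_mul_right f hq.le).trans (Nat.le_add_right _ _)
      refine ev_rdE_bits hs hbase (he.mul hs.ev_fE (by omega)) hs.ev_fE hfw (hbound _ hle) ?_
        (groupDir_lt hs hβ (not_le.mp hsp) hq)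
      exact hat.left.trans (at_array _ hq)
    have hj := hrI.div hs.ev_tE
    have hss := hrI.mod hs.ev_tE
    have hjt : r / t < t := by rwa [Nat.div_lt_iff_lt_mul ht0]
    have hst : r % t < t := Nat.mod_lt _ ht0
    have hrjs : r / t * t + r % t = r := Nat.div_add_mod' r t
    set j := r / t
    set s := r % t
    clear_value j s
    have htt1 : t * 1 ≤ t * t := Nat.mul_le_mul_left _ ht0
    have hsq := hs.sq_lt
    have h100 : 100 * t ≤ t * t := Nat.mul_le_mul_right _ ht
    have hrel := hdir hj (by omega)
    have htj := hs.ev_tE (x := x) |>.add hj (by omega)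
    have hp := hdir htj (by omega)
    have ht2 := hs.ev_tE (x := x) |>.add hs.ev_tE (by omega)
    have httj := ht2.add hj (by omega)
    have hspan := hdir httj (by omega)
    rw [groupDir, if_pos hjt] at hrel
    rw [groupDir, if_neg (by omega), if_pos (by omega), Nat.add_sub_cancel_left] at hp
    rw [groupDir, if_neg (by omega), if_neg (by omega),
      show t + t + j - 2 * t = j by omega] at hspan
    set J := g * t + j with hJ
    have hIJ : J * t + s = I := by rw [← hIgr, ← hrjs, hJ]; ring
    have hfJ : β (g * t * t) ≤ β (J * t) := hβ (Nat.mul_le_mul_right _ (by omega))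
    have hJI : β (J * t) ≤ β I := hβ (by omega)
    have hpr := (hs.ev_wordE h0 hgI hgG (by omega)).add hrel (by omega)
    rw [Nat.add_sub_cancel' hfJ] at hpr
    set p := 3 * t * f + ∑ j ∈ Finset.range j, (subBits t f β (g * t + j)).length with hp'
    have hple : p + (subBits t f β J).length ≤ (denseBits t f β g).length := by
      rw [denseBits, List.length_append, length_array, length_cat, hp', add_assoc, hJ,
        ← Finset.sum_range_succ (fun j => (subBits t f β (g * t + j)).length)]
      exact Nat.add_le_add_left (Finset.sum_le_sum_of_subset (Finset.range_mono hjt)) _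
    have hsub : At D (A * w + p) (subBits t f β J) := by
      have := hat.right.trans (at_cat (fun j => subBits t f β (g * t + j)) hjt)
      rwa [length_array, add_assoc] at this
    have hval : β (J * t) + subVal t β J s = β I := by
      rw [subVal, hIJ, Nat.add_sub_cancel' hJI]
    rw [← hval]
    refine hpr.add ?_ (by omega)
    have hsv := subVal_le hβ J hst
    have h2tw : t + t < w := by have := hs.t_le; omega
    by_cases hlts : subSpan t β J < t
    · refine Ev.ite_pos hspan hs.ev_tE hlts ?_
      -- The code length is not computed: `2 * t` bits are read, at least as many as the code has,
      -- and the table ignores the rest.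
      have hX := ev_rdE hs.ev_wE hbase hp ht2 h2tw (hbound p (by omega))
      have hXlt := rd_lt D (A * w + p) (t + t)
      rw [subBits, if_pos hlts] at hsub
      have hzle : monoLen t f (subSpan t β J) ≤ t + t :=
        (min_le_right _ _).trans (by omega)
      have hXmod := rd_mod (D := D) (p := A * w + p) hzle
      have ht1 : t + 1 ≤ 2 ^ f := by
        have := hs.pow_t
        have : t * 1 < t ^ 4 := by
          rw [show t ^ 4 = t * t ^ 3 by ring]
          exact Nat.mul_lt_mul_of_pos_left (Nat.one_lt_pow (by norm_num) (by omega)) ht0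
        omega
      rw [hsub.rd_bits (monoCode_lt (subVal_mono hβ J) (fun _ h => subVal_le hβ J h) ht1)]
        at hXmod
      set X := rd D (A * w + p) (t + t) with hXdef
      have hidx : subSpan t β J * 2 ^ (t + t) + X < t * 2 ^ (2 * t) := by
        rw [two_mul]
        calc _ < subSpan t β J * 2 ^ (t + t) + 2 ^ (t + t) := by omega
          _ = (subSpan t β J + 1) * 2 ^ (t + t) := by ring
          _ ≤ _ := Nat.mul_le_mul_right _ hlts
      have hidx2 : (subSpan t β J * 2 ^ (t + t) + X) * t + s < t * 2 ^ (2 * t) * t := by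
        calc _ < (subSpan t β J * 2 ^ (t + t) + X) * t + t := by omega
          _ = (subSpan t β J * 2 ^ (t + t) + X + 1) * t := by ring
          _ ≤ _ := Nat.mul_le_mul_right _ hidx
      -- The section bound for the table itself shows that index arithmetic stays within a word.
      have hTlt : t * 2 ^ (2 * t) * t < 2 ^ w := by
        obtain ⟨aT, -, -, hT⟩ := h4.2
        rw [monoTable, length_array, Nat.mul_div_cancel _ hw0] at hT
        omega
      have hle1 : subSpan t β J * 2 ^ (t + t) + X ≤ (subSpan t β J * 2 ^ (t + t) + X) * t :=
        Nat.le_mul_of_pos_right _ ht0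
      have hev := (((hspan.mul (ht2.pow h2tw) (by omega)).add hX (by omega)).mul hs.ev_tE
        (by omega)).add hss (by omega)
      have e1 : ((subSpan t β J * 2 ^ (t + t) + X) * t + s) / t =
          subSpan t β J * 2 ^ (t + t) + X := by
        rw [mul_comm _ t, Nat.mul_add_div ht0, Nat.div_eq_of_lt hst, add_zero]
      have e2 : ((subSpan t β J * 2 ^ (t + t) + X) * t + s) % t = s := by
        rw [mul_comm _ t, Nat.mul_add_mod, Nat.mod_eq_of_lt hst]
      have e3 : (subSpan t β J * 2 ^ (t + t) + X) / 2 ^ (2 * t) = subSpan t β J := by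
        rw [two_mul, mul_comm _ (2 ^ (t + t)), Nat.mul_add_div (by positivity),
          Nat.div_eq_of_lt hXlt, add_zero]
      have e4 : (subSpan t β J * 2 ^ (t + t) + X) % 2 ^ (2 * t) = X := by
        rw [two_mul, mul_comm _ (2 ^ (t + t)), Nat.mul_add_mod, Nat.mod_eq_of_lt hXlt]
      have hent : monoDecode t (subSpan t β J) (X % 2 ^ monoLen t f (subSpan t β J)) s =
          subVal t β J s := by
        rw [hXmod]
        exact monoDecode_monoCode (subVal_mono hβ J) (fun _ h => subVal_le hβ J h) hst
      have := hs.ev_wordE h4 hev hidx2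
        (by simp only [e1, e2, e3, e4, hent]; omega)
      simpa only [e1, e2, e3, e4, hent] using this
    · refine Ev.ite_neg hspan hs.ev_tE hlts ?_
      rw [subBits, if_neg hlts] at hsub hple
      rw [length_array] at hple
      have hsf : s * f ≤ t * f := Nat.mul_le_mul_right _ hst.le
      have h3t : groupDir t f β g (2 * t + j) < 2 ^ f :=
        groupDir_lt hs hβ (not_le.mp hsp) (by omega)
      rw [groupDir, if_neg (by omega), if_neg (by omega), Nat.add_sub_cancel_left] at h3t
      refine ev_rdE_bits hs hbase (hp.add (hss.mul hs.ev_fE (by omega)) (by omega)) hs.ev_fE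
        hfw (hbound _ (by omega)) ?_ (lt_of_le_of_lt hsv h3t)
      rw [← add_assoc]
      exact hsub.trans (at_array _ hst)

theorem sum_groupSpan (hβ : Monotone β) (G : ℕ) :
    ∑ g ∈ Finset.range G, groupSpan t β g = β (G * t * t) - β 0 := by
  induction G with
  | zero => simp
  | succ n ih =>
    rw [Finset.sum_range_succ, ih, groupSpan]
    have h1 : β 0 ≤ β (n * t * t) := hβ (by omega)
    have h2 : β (n * t * t) ≤ β ((n * t + t) * t) := hβ (Nat.mul_le_mul_right _ (by omega))
    rw [show (n + 1) * t * t = (n * t + t) * t by ring]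
    omega

/-- The group spans telescope to at most `M`; the number of entries enters only through the number
`G` of groups, for directories and padding. -/
theorem mul_length_groupData_le (hβ : Monotone β) (hw : 0 < w) {M : ℕ} (hM : ∀ i, β i ≤ M)
    (G : ℕ) : t * (groupData w t f β G).length ≤
      G * (t * (3 * t * f + w)) + M * (t * f + w) := by
  rw [groupData, length_cat_pad hw, Finset.sum_mul, Finset.mul_sum]
  have h1 : ∀ g ∈ Finset.range G, t * (words w (groupBits w t f β g) * w) ≤
      t * (3 * t * f + w) + groupSpan t β g * (t * f + w) := by
    intro g _
    have h2 := Nat.mul_le_mul_left t (words_mul_le w (groupBits w t f β g))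
    have h3 := mul_length_groupBits_le (w := w) (f := f) (t := t) hβ g
    nlinarith
  refine (Finset.sum_le_sum h1).trans ?_
  rw [Finset.sum_add_distrib, Finset.sum_const, Finset.card_range, smul_eq_mul, ← Finset.sum_mul,
    sum_groupSpan hβ]
  exact Nat.add_le_add_left (Nat.mul_le_mul_right _ ((Nat.sub_le _ _).trans (hM _))) _

end MonoLemmas

/-! ### The dictionary -/

/-- Membership in a set (`q = true`) or in its complement (`q = false`). -/
def Col (q : Bool) (S : Finset ℕ) (y : ℕ) : Prop := decide (y ∈ S) = q

instance (q : Bool) (S : Finset ℕ) : DecidablePred (Col q S) := fun _ =>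
  inferInstanceAs (Decidable (_ = _))

section Dictionary

variable (w t f M : ℕ) (q : Bool) (S : Finset ℕ)

/-- The elements of block `b`, relative to its beginning. -/
def block (b : ℕ) : Finset ℕ := (Finset.range t).filter fun j => b * t + j ∈ S

def blockLen (k : ℕ) : ℕ := Nat.clog 2 (t.choose k)

def blocksOfCard (k : ℕ) : Finset (Finset ℕ) := Finset.powersetCard k (Finset.range t)

/-- The code of a block among the blocks with the same number of elements. -/
noncomputable def blockBits (b : ℕ) : List Bool :=
  bits (blockLen t (block t S b).card)
    (encode (blocksOfCard t (block t S b).card) (block t S b))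

/-- The position of the code of block `b`. -/
def blockPtr (b : ℕ) : ℕ := ∑ c ∈ Finset.range b, blockLen t (block t S c).card

/-- The number of elements before block `b`. -/
def blockRank (b : ℕ) : ℕ := Nat.count (Col q S) (b * t)

/-- The block that contains the element with `i` predecessors. -/
def blockSelect (i : ℕ) : ℕ := Nat.findGreatest (fun b => blockRank t q S b ≤ i) M

/-- The block that is encoded in the index of a table entry. -/
noncomputable def tableBlock (I : ℕ) : Finset ℕ :=
  decode (blocksOfCard t (I / t / 2 ^ t)) (I / t % 2 ^ t % 2 ^ blockLen t (I / t / 2 ^ t))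

noncomputable def table (F : Finset ℕ → ℕ → ℕ) : List Bool :=
  array w ((t + 1) * 2 ^ t * t) fun I => F (tableBlock t I) (I % t)

/-- The value `t` marks a non-member; the rank of a member inside a block is always smaller. -/
def localRank (A : Finset ℕ) (j : ℕ) : ℕ := if Col q A j then Nat.count (Col q A) j else t

noncomputable def localSelect (A : Finset ℕ) (s : ℕ) : ℕ := Nat.nth (Col q A) s

/-- The sections of the memory that are used for `S` (`q = true`) or its complement. -/
noncomputable def colSection : ℕ → List Bool
  | 0 => stepWords w t M (blockRank t q S)
  | 1 => stepFields t f M (blockRank t q S)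
  | 2 => groupFirst w t (blockSelect t M q S) (M / t + 1)
  | 3 => groupFlag w t (blockSelect t M q S) (M / t + 1)
  | 4 => groupPtr w t f (blockSelect t M q S) (M / t + 1)
  | 5 => groupData w t f (blockSelect t M q S) (M / t + 1)
  | 6 => monoTable w t f
  | 7 => table w t (localRank t q)
  | _ => table w t (localSelect q)

noncomputable def blockSection : ℕ → List Bool
  | 0 => stepWords w t M (blockPtr t S)
  | 1 => stepFields t f M (blockPtr t S)
  | 2 => array f M fun b => (block t S b).card
  | _ => cat M (blockBits t S)

/-- The number of the first section for `S` or its complement. -/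
def colBase (q : Bool) : ℕ := if q then 4 else 13

/-- The bit string `D` contains all sections. -/
structure Stored (D : List Bool) : Prop extends Setup w t f D where
  sec_block : ∀ k < 4, Sec w D k (blockSection w t f M S k)
  sec_col : ∀ (q : Bool), ∀ k < 9, Sec w D (colBase q + k) (colSection w t f M q S k)
  fields_lt : M * f < 2 ^ w
  blocks_lt : ∀ b < M, b * t < 2 ^ w

end Dictionary

/-- Entry `j` for block `b` of the table in section `k`. -/
def tableE (k : ℕ) (b j : Expr) : Expr :=
  wordE k ((fieldE 2 b * powE tE + rdE (secE 3) (stepE 0 1 b) tE) * tE + j)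

def rankE (q : Bool) : Expr :=
  let e := tableE (colBase q + 7) (.arg / tE) (.arg % tE)
  .ite e tE (stepE (colBase q) (colBase q + 1) (.arg / tE) + e) (.const 0 - .const 1)

def selectE (q : Bool) : Expr :=
  let i := .arg - .const 1
  let b := monoE (colBase q + 2) i
  b * tE + tableE (colBase q + 8) b (i - stepE (colBase q) (colBase q + 1) b)

/-! ### Correctness of the rank and select expressions. -/

section DictionaryLemmas

variable {w t f M : ℕ} {q : Bool} {S : Finset ℕ} {D : List Bool} {x : BitVec w}

theorem block_mem (b : ℕ) : block t S b ∈ blocksOfCard t (block t S b).card := by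
  rw [blocksOfCard, Finset.mem_powersetCard]
  exact ⟨Finset.filter_subset _ _, rfl⟩

theorem card_block_le (b : ℕ) : (block t S b).card ≤ t :=
  (Finset.card_filter_le _ _).trans (by simp)

theorem blockLen_le (k : ℕ) : blockLen t k ≤ t := by
  rw [blockLen]
  exact Nat.clog_le_of_le_pow (Nat.choose_le_two_pow t k)

theorem encode_block_lt (b : ℕ) :
    encode (blocksOfCard t (block t S b).card) (block t S b) <
      2 ^ blockLen t (block t S b).card := by
  refine (encode_lt (block_mem b)).trans_le ?_
  rw [blocksOfCard, Finset.card_powersetCard, Finset.card_range]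
  exact Nat.le_pow_clog (by norm_num) _

theorem col_block {b j : ℕ} (hj : j < t) : Col q (block t S b) j ↔ Col q S (b * t + j) := by
  simp [Col, block, hj]

theorem count_col_block {b j : ℕ} (hj : j ≤ t) :
    Nat.count (Col q (block t S b)) j = Nat.count (fun k => Col q S (b * t + k)) j := by
  rw [Nat.count_eq_card_filter_range, Nat.count_eq_card_filter_range]
  congr 1
  apply Finset.filter_congr
  intro k hk
  rw [Finset.mem_range] at hk
  exact col_block (by omega)

theorem blockPtr_mono : Monotone (blockPtr t S) := fun _ _ h =>
  Finset.sum_le_sum_of_subset (Finset.range_mono h)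

theorem blockPtr_succ_le (b : ℕ) : blockPtr t S (b + 1) ≤ blockPtr t S b + t := by
  rw [blockPtr, Finset.sum_range_succ]
  exact Nat.add_le_add_left (blockLen_le _) _

theorem blockPtr_le (b : ℕ) : blockPtr t S b ≤ b * t := by
  induction b with
  | zero => simp [blockPtr]
  | succ b ih =>
    have := blockPtr_succ_le (t := t) (S := S) b
    rw [add_mul, one_mul]; omega

theorem blockRank_mono : Monotone (blockRank t q S) := fun _ _ h =>
  Nat.count_monotone _ (Nat.mul_le_mul_right _ h)

theorem blockRank_succ_le (b : ℕ) : blockRank t q S (b + 1) ≤ blockRank t q S b + t := by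
  rw [blockRank, add_mul, one_mul, Nat.count_add]
  exact Nat.add_le_add_left (Nat.count_le _) _

theorem blockRank_le (b : ℕ) : blockRank t q S b ≤ b * t := Nat.count_le _

theorem blockSelect_mono : Monotone (blockSelect t M q S) := fun _ _ h =>
  Nat.findGreatest_mono (fun _ h' => le_trans h' h) le_rfl

theorem blockSelect_le (i : ℕ) : blockSelect t M q S i ≤ M := Nat.findGreatest_le _

theorem blockRank_blockSelect_le (i : ℕ) : blockRank t q S (blockSelect t M q S i) ≤ i :=
  Nat.findGreatest_spec (P := fun b => blockRank t q S b ≤ i) (Nat.zero_le M)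
    (by simp [blockRank])

theorem blockSelect_lt {i : ℕ} (hi : i < blockRank t q S M) : blockSelect t M q S i < M := by
  refine lt_of_le_of_ne (blockSelect_le i) fun h => ?_
  have := blockRank_blockSelect_le (t := t) (M := M) (q := q) (S := S) i
  rw [h] at this
  omega

/-- By maximality in `blockSelect`. Together with `blockRank_blockSelect_le` it places the element
with `i` predecessors in the selected block. -/
theorem lt_blockRank_blockSelect_succ {i : ℕ} (hi : i < blockRank t q S M) :
    i < blockRank t q S (blockSelect t M q S i + 1) := by
  by_contra! h
  have h1 := Nat.le_findGreatest (P := fun b => blockRank t q S b ≤ i) (blockSelect_lt hi) h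
  rw [← blockSelect] at h1
  omega

theorem Stored.ev_tableE (hs : Stored w t f M S D) {k B s : ℕ} {F : Finset ℕ → ℕ → ℕ} {b j : Expr}
    (hk : Sec w D k (table w t F)) (hb : Ev w D x b B) (hB : B < M) (hj : Ev w D x j s)
    (hst : s < t) (hF : F (block t S B) s < 2 ^ w) :
    Ev w D x (tableE k b j) (F (block t S B) s) := by
  have ht := hs.le_t
  have ht0 : 0 < t := by omega
  have htw : t < w := by have := hs.t_le; omega
  have hw0 : 0 < w := by omega
  have hcard : (block t S B).card < 2 ^ f := by
    have h1 := hs.pow_t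
    have h2 := card_block_le (t := t) (S := S) B
    have : t * 1 < t ^ 4 := by
      rw [show t ^ 4 = t * t ^ 3 by ring]
      exact Nat.mul_lt_mul_of_pos_left (Nat.one_lt_pow (by norm_num) (by omega)) ht0
    omega
  have hcls := hs.ev_fieldE (hs.sec_block 2 (by norm_num)) hb hB hcard hs.fields_lt
  have hPlt : blockPtr t S B < 2 ^ w := (blockPtr_le B).trans_lt (hs.blocks_lt B hB)
  have hP := hs.ev_stepE (hs.sec_block 0 (by norm_num)) (hs.sec_block 1 (by norm_num))
    blockPtr_mono blockPtr_succ_le hb hB hPlt hs.fields_lt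
  obtain ⟨a, ha, hY, hlen⟩ := hs.ev_secE (x := x) (hs.sec_block 3 (by norm_num))
  have hlen' : blockPtr t S B ≤ (cat M (blockBits t S)).length := by
    rw [length_cat]
    simp only [blockBits, length_bits]
    exact blockPtr_mono hB.le
  have hX := ev_rdE hs.ev_wE ha hP hs.ev_tE htw (by
    have := Nat.div_le_div_right (c := w) hlen'
    simp only [blockSection] at hlen
    omega)
  have hat : At D (a * w + blockPtr t S B) (blockBits t S B) := by
    have := hY.trans (at_cat (blockBits t S) hB)
    simpa only [blockBits, length_bits, blockPtr] using this
  have hXlt := rd_lt D (a * w + blockPtr t S B) t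
  -- As for monotone codes, `t` bits are read whatever the code length is, and the remainder modulo
  -- `2 ^ blockLen` is the code.
  have hXmod := rd_mod (D := D) (p := a * w + blockPtr t S B)
    (blockLen_le (t := t) (block t S B).card)
  rw [blockBits] at hat
  rw [hat.rd_bits (encode_block_lt B)] at hXmod
  set X := rd D (a * w + blockPtr t S B) t with hXdef
  set c := (block t S B).card with hc
  have hct : c ≤ t := card_block_le B
  have hidx : c * 2 ^ t + X < (t + 1) * 2 ^ t := by
    calc _ < c * 2 ^ t + 2 ^ t := by omega
      _ = (c + 1) * 2 ^ t := by ring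
      _ ≤ _ := Nat.mul_le_mul_right _ (by omega)
  have hidx2 : (c * 2 ^ t + X) * t + s < (t + 1) * 2 ^ t * t := by
    calc _ < (c * 2 ^ t + X) * t + t := by omega
      _ = (c * 2 ^ t + X + 1) * t := by ring
      _ ≤ _ := Nat.mul_le_mul_right _ hidx
  have hTlt : (t + 1) * 2 ^ t * t < 2 ^ w := by
    obtain ⟨aT, -, -, hT⟩ := hk.2
    rw [table, length_array, Nat.mul_div_cancel _ hw0] at hT
    omega
  have hle1 : c * 2 ^ t + X ≤ (c * 2 ^ t + X) * t := Nat.le_mul_of_pos_right _ ht0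
  have hev := (((hcls.mul (hs.ev_tE.pow htw) (by omega)).add hX (by omega)).mul hs.ev_tE
    (by omega)).add hj (by omega)
  have e1 : ((c * 2 ^ t + X) * t + s) / t = c * 2 ^ t + X := by
    rw [mul_comm _ t, Nat.mul_add_div ht0, Nat.div_eq_of_lt hst, add_zero]
  have e2 : ((c * 2 ^ t + X) * t + s) % t = s := by
    rw [mul_comm _ t, Nat.mul_add_mod, Nat.mod_eq_of_lt hst]
  have e3 : (c * 2 ^ t + X) / 2 ^ t = c := by
    rw [mul_comm _ (2 ^ t), Nat.mul_add_div (by positivity), Nat.div_eq_of_lt hXlt, add_zero]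
  have e4 : (c * 2 ^ t + X) % 2 ^ t = X := by
    rw [mul_comm _ (2 ^ t), Nat.mul_add_mod, Nat.mod_eq_of_lt hXlt]
  have hent : tableBlock t ((c * 2 ^ t + X) * t + s) = block t S B := by
    rw [tableBlock, e1, e3, e4, hXmod]
    exact decode_encode (block_mem B)
  have := hs.ev_wordE hk hev hidx2 (by simp only [e2, hent]; exact hF)
  simpa only [e2, hent, tableE] using this

theorem Stored.ev_blockRank (hs : Stored w t f M S D) {B : ℕ} {b : Expr} (hb : Ev w D x b B)
    (hB : B < M) :
    Ev w D x (stepE (colBase q) (colBase q + 1) b) (blockRank t q S B) :=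
  hs.ev_stepE (hs.sec_col q 0 (by norm_num)) (hs.sec_col q 1 (by norm_num)) blockRank_mono
    blockRank_succ_le hb hB ((blockRank_le B).trans_lt (hs.blocks_lt B hB)) hs.fields_lt

theorem Setup.t_lt_two_pow (hs : Setup w t f D) : t < 2 ^ w := by
  have := hs.t_le
  exact lt_of_le_of_lt (by omega) Nat.lt_two_pow_self

theorem Stored.ev_rankE (hs : Stored w t f M S D) {y : ℕ} (hy : Ev w D x .arg y)
    (hyM : y / t < M) :
    (Col q S y → Ev w D x (rankE q) (Nat.count (Col q S) y)) ∧
      (¬ Col q S y → (rankE q).eval (memOf w D) x = BitVec.ofInt w (-1)) := by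
  have ht0 : 0 < t := by have := hs.le_t; omega
  have hmod : y % t < t := Nat.mod_lt _ ht0
  have hdm : y / t * t + y % t = y := Nat.div_add_mod' y t
  have hcol := col_block (q := q) (S := S) (b := y / t) hmod
  rw [hdm] at hcol
  have hcnt : Nat.count (Col q (block t S (y / t))) (y % t) < t := (Nat.count_le _).trans_lt hmod
  have ht2 := hs.t_lt_two_pow
  have he := hs.ev_tableE (hs.sec_col q 7 (by norm_num)) (hy.div hs.ev_tE) hyM
    (hy.mod hs.ev_tE) hmod (by rw [localRank]; split_ifs <;> omega)
  constructor
  · intro h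
    have hc : localRank t q (block t S (y / t)) (y % t) =
        Nat.count (Col q (block t S (y / t))) (y % t) := by rw [localRank, if_pos (hcol.mpr h)]
    rw [hc] at he
    have hsum : blockRank t q S (y / t) + Nat.count (Col q (block t S (y / t))) (y % t) =
        Nat.count (Col q S) y := by
      rw [count_col_block hmod.le, blockRank, ← Nat.count_add, hdm]
    have hle : Nat.count (Col q S) y ≤ y := Nat.count_le _
    have hylt := hy.lt
    have := (hs.ev_blockRank (q := q) (hy.div hs.ev_tE) hyM).add he (by omega)
    rw [hsum] at this
    exact Ev.ite_pos he hs.ev_tE hcnt this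
  · intro h
    have hc : localRank t q (block t S (y / t)) (y % t) = t := by
      rw [localRank, if_neg (fun h' => h (hcol.mp h'))]
    rw [hc] at he
    have h1 : (rankE q).eval (memOf w D) x =
        (Expr.const 0 - Expr.const 1).eval (memOf w D) x := by
      apply BitVec.eq_of_toNat_eq
      exact Ev.ite_neg he hs.ev_tE (lt_irrefl t) rfl
    rw [h1, eval_neg_one]

/-- The selected block `B` satisfies `blockRank B ≤ i - 1 < blockRank (B + 1)`, so the answer is the
element of `B` with `i - 1 - blockRank B` predecessors inside `B`, which the table supplies. It is
identified with `Nat.nth` by counting its predecessors. -/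
theorem Stored.ev_selectE (hs : Stored w t f M S D) {i : ℕ} (hi : Ev w D x .arg i) (h1 : 1 ≤ i)
    (hiM : i - 1 < blockRank t q S M) (hlt : Nat.nth (Col q S) (i - 1) < 2 ^ w) :
    Ev w D x (selectE q) (Nat.nth (Col q S) (i - 1)) := by
  have ht0 : 0 < t := by have := hs.le_t; omega
  have ht2 := hs.t_lt_two_pow
  have hi' := hi.sub (ev_const (a := 1) (hs.lt_two_pow (by norm_num))) h1
  set I := i - 1 with hI
  have hBlt := blockSelect_lt hiM
  have hBle := blockRank_blockSelect_le (t := t) (M := M) (q := q) (S := S) I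
  have hBgt := lt_blockRank_blockSelect_succ hiM
  -- There are at most `M * t` elements in `M` blocks, and `M / t + 1` groups of `t * t` entries
  -- cover that many indices.
  have hMG : I < (M / t + 1) * t * t := by
    have e1 := blockRank_le (t := t) (q := q) (S := S) M
    have e2 : M * t ≤ (M / t + 1) * t * t := Nat.mul_le_mul_right _ (by
      have := Nat.lt_div_mul_add (a := M) ht0
      rw [add_mul]; omega)
    omega
  have hB2 := hs.blocks_lt _ hBlt
  have hB2' : blockSelect t M q S I ≤ blockSelect t M q S I * t :=
    Nat.le_mul_of_pos_right _ ht0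
  have hb := hs.ev_monoE (β := blockSelect t M q S) blockSelect_mono
    (hs.sec_col q 2 (by norm_num)) (hs.sec_col q 3 (by norm_num)) (hs.sec_col q 4 (by norm_num))
    (hs.sec_col q 5 (by norm_num)) (hs.sec_col q 6 (by norm_num)) hi' hMG (by omega)
  set B := blockSelect t M q S I with hB
  set A := block t S B with hA
  have hs' := hi'.sub (hs.ev_blockRank (q := q) hb hBlt) hBle
  set s := I - blockRank t q S B with hsdef
  have hcnt : s < Nat.count (Col q A) t := by
    rw [count_col_block le_rfl]
    rw [blockRank, add_mul, one_mul, Nat.count_add, ← blockRank] at hBgt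
    omega
  have hst : s < t := hcnt.trans_le (Nat.count_le _)
  have hnth : Nat.nth (Col q A) s < t := Nat.nth_lt_of_lt_count hcnt
  have hcard : ∀ hf : (Set.ofPred (Col q A)).Finite, s < hf.toFinset.card := fun hf =>
    hcnt.trans_le (Nat.count_le_card hf t)
  have hmem : Col q A (Nat.nth (Col q A) s) := Nat.nth_mem s hcard
  have hcn : Nat.count (Col q A) (Nat.nth (Col q A) s) = s := Nat.count_nth hcard
  have hmemS : Col q S (B * t + Nat.nth (Col q A) s) := (col_block hnth).mp hmem
  have hcS : Nat.count (Col q S) (B * t + Nat.nth (Col q A) s) = I := by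
    rw [Nat.count_add, ← count_col_block hnth.le, ← hA, hcn, ← blockRank]
    omega
  have hans : Nat.nth (Col q S) I = B * t + Nat.nth (Col q A) s := by
    rw [← hcS]; exact Nat.nth_count hmemS
  have htab := hs.ev_tableE (hs.sec_col q 8 (by norm_num)) hb hBlt hs' hst
    (by rw [localSelect, ← hA]; omega)
  rw [hans] at hlt ⊢
  exact (hb.mul hs.ev_tE hB2).add htab hlt

end DictionaryLemmas

/-! ### The layout of the memory -/

section Layout

variable (w t f K : ℕ) (secs : ℕ → List Bool)

/-- Word `0` is the flag for this representation. Words `1` to `3` give the fixed programs their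
parameters, and the remaining words are the section addresses, counted in words. -/
def header : ℕ → ℕ
  | 0 => 1
  | 1 => w
  | 2 => t
  | 3 => f
  | k + 4 => 4 + K + ∑ j ∈ Finset.range k, words w (secs j)

def layout : List Bool :=
  array w (4 + K) (header w t f K secs) ++ cat K fun k => pad w (secs k)

variable {w t f K secs}

theorem length_layout (hw : 0 < w) :
    (layout w t f K secs).length = (4 + K + ∑ j ∈ Finset.range K, words w (secs j)) * w := by
  rw [layout, List.length_append, length_array, length_cat_pad hw, ← add_mul]

theorem rd_layout {k : ℕ} (hk : k < 4 + K) (h : header w t f K secs k < 2 ^ w) :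
    rd (layout w t f K secs) (k * w) w = header w t f K secs k :=
  ((at_array _ hk).of_append_left).rd_bits h

theorem sec_layout (hw : 0 < w) (hK : K ≤ 60)
    (h : 4 + K + ∑ j ∈ Finset.range K, words w (secs j) + 1 < 2 ^ w) {k : ℕ} (hk : k < K) :
    Sec w (layout w t f K secs) k (secs k) := by
  have hle : (∑ j ∈ Finset.range k, words w (secs j)) + words w (secs k) ≤
      ∑ j ∈ Finset.range K, words w (secs j) := by
    rw [← Finset.sum_range_succ]
    exact Finset.sum_le_sum_of_subset (Finset.range_mono hk)
  have hh : header w t f K secs (4 + k) =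
      4 + K + ∑ j ∈ Finset.range k, words w (secs j) := by
    rw [add_comm 4 k]; rfl
  refine ⟨by omega, 4 + K + ∑ j ∈ Finset.range k, words w (secs j), ?_, ?_, ?_⟩
  · rw [← hh]
    exact rd_layout (by omega) (by omega)
  · rw [add_mul]
    have := (At.append_right (array w (4 + K) (header w t f K secs))
      (cat K fun k => pad w (secs k))).trans (at_cat_pad hw secs hk)
    rwa [length_array] at this
  · have := length_div_le_words w (secs k)
    omega

end Layout

/-- All sections of the dictionary. -/
noncomputable def sections (w t f M : ℕ) (S : Finset ℕ) (k : ℕ) : List Bool :=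
  if k < 4 then blockSection w t f M S k
  else if k < 13 then colSection w t f M true S (k - 4)
  else colSection w t f M false S (k - 13)

noncomputable def dictionary (w t f M : ℕ) (S : Finset ℕ) : List Bool :=
  layout w t f 22 (sections w t f M S)

theorem dictionary_stored {w t f M : ℕ} {S : Finset ℕ} (hwt : 8 * t ≤ w) (ht : 100 ≤ t)
    (hft : f ≤ t) (htf : t ^ 4 ≤ 2 ^ f) (hMf : M * f < 2 ^ w) (hMt : ∀ b < M, b * t < 2 ^ w)
    (hlen : (dictionary w t f M S).length + w < 2 ^ w * w) :
    Stored w t f M S (dictionary w t f M S) := by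
  have hw : 0 < w := by omega
  have hww : w < 2 ^ w := Nat.lt_two_pow_self
  rw [dictionary, length_layout hw, ← add_one_mul] at hlen
  have hlen' := lt_of_mul_lt_mul_right hlen (Nat.zero_le w)
  have hsec := fun k (hk : k < 22) => sec_layout (t := t) (f := f) hw (by norm_num) hlen' hk
  refine ⟨⟨?_, ?_, ?_, hwt, ht, hft, htf⟩, ?_, ?_, hMf, hMt⟩
  · exact rd_layout (k := 1) (by norm_num) hww
  · exact rd_layout (k := 2) (by norm_num) (show t < 2 ^ w by omega)
  · exact rd_layout (k := 3) (by norm_num) (show f < 2 ^ w by omega)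
  · intro k hk
    have := hsec k (by omega)
    rwa [sections, if_pos hk] at this
  · rintro (_ | _) k hk
    · have := hsec (13 + k) (by omega)
      rwa [sections, if_neg (by omega), if_neg (by omega), Nat.add_sub_cancel_left] at this
    · have := hsec (4 + k) (by omega)
      rwa [sections, if_neg (by omega), if_pos (by omega), Nat.add_sub_cancel_left] at this

/-! ### The size of the dictionary -/

/-- `hM` keeps each table within `c * M` bits. Apart from the codes, the block sections take `2 * M
* f + 2 * c * M` bits, each of the two colours `8 * M * f + 14 * c * M`, and the header with the
padding `48 * w ≤ c * M`. Since `M * f` and `c * M` are at most `c * M * f`, this makes `49` such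
units. -/
theorem length_dictionary_le {w t f M c : ℕ} (S : Finset ℕ) (ht : 100 ≤ t) (hw : 0 < w)
    (hf : 1 ≤ f) (hwc : w ≤ c * t) (hM : t ^ 3 * 2 ^ (2 * t) ≤ M) :
    (dictionary w t f M S).length ≤ blockPtr t S M + 50 * c * (M * f) := by
  have ht0 : 0 < t := by omega
  have hc : 0 < c := by
    rcases Nat.eq_zero_or_pos c with rfl | h
    · omega
    · exact h
  have h2t : 1 ≤ 2 ^ (2 * t) := Nat.one_le_two_pow
  have hMt : t ≤ M := by
    refine le_trans ?_ hM
    calc t = t * 1 := by ring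
      _ ≤ t ^ 3 * 2 ^ (2 * t) := Nat.mul_le_mul (Nat.le_self_pow (by norm_num) t) h2t
  have hMt48 : 48 * t ≤ M := by
    refine le_trans ?_ hM
    calc 48 * t ≤ (t * t) * t := Nat.mul_le_mul_right _ (by nlinarith)
      _ = t ^ 3 * 1 := by ring
      _ ≤ t ^ 3 * 2 ^ (2 * t) := Nat.mul_le_mul_left _ h2t
  have hG : (M / t + 1) * t ≤ 2 * M := by
    have := Nat.div_mul_le_self M t
    rw [add_mul]; omega
  have hwords : (M / t + 1) * w ≤ 2 * (c * M) := by
    calc (M / t + 1) * w ≤ (M / t + 1) * (c * t) := Nat.mul_le_mul_left _ hwc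
      _ = c * ((M / t + 1) * t) := by ring
      _ ≤ c * (2 * M) := Nat.mul_le_mul_left _ hG
      _ = _ := by ring
  have hmono : t * 2 ^ (2 * t) * t * w ≤ c * M := by
    calc t * 2 ^ (2 * t) * t * w ≤ t * 2 ^ (2 * t) * t * (c * t) := Nat.mul_le_mul_left _ hwc
      _ = c * (t ^ 3 * 2 ^ (2 * t)) := by ring
      _ ≤ _ := Nat.mul_le_mul_left _ hM
  have htab : (t + 1) * 2 ^ t * t * w ≤ c * M := by
    refine le_trans (Nat.mul_le_mul_right w (Nat.mul_le_mul_right t ?_)) hmono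
    have h1 : 2 ^ (2 * t) = 2 ^ t * 2 ^ t := by rw [two_mul, pow_add]
    have h2 : 2 ≤ 2 ^ t := by
      calc 2 = 2 ^ 1 := by norm_num
        _ ≤ 2 ^ t := Nat.pow_le_pow_right two_pos (by omega)
    rw [h1, ← mul_assoc]
    refine Nat.mul_le_mul_right _ ?_
    nlinarith
  have hdata : ∀ q, (groupData w t f (blockSelect t M q S) (M / t + 1)).length ≤
      7 * (M * f) + 3 * (c * M) := by
    intro q
    have h := mul_length_groupData_le (w := w) (t := t) (f := f)
      (blockSelect_mono (t := t) (M := M) (q := q) (S := S)) hw blockSelect_le (M / t + 1)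
    refine Nat.le_of_mul_le_mul_left (h.trans ?_) ht0
    have e1 : (M / t + 1) * (t * (3 * t * f + w)) ≤ 2 * M * (3 * t * f + w) := by
      rw [← mul_assoc]; exact Nat.mul_le_mul_right _ hG
    have e2 : M * w ≤ M * (c * t) := Nat.mul_le_mul_left _ hwc
    nlinarith
  have hcf : c * M ≤ c * (M * f) := Nat.mul_le_mul_left _ (Nat.le_mul_of_pos_right _ hf)
  have hff : M * f ≤ c * (M * f) := Nat.le_mul_of_pos_left _ hc
  have h48 : 48 * w ≤ c * M := by
    calc 48 * w ≤ 48 * (c * t) := Nat.mul_le_mul_left _ hwc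
      _ = c * (48 * t) := by ring
      _ ≤ _ := Nat.mul_le_mul_left _ hMt48
  have hcat : (cat M (blockBits t S)).length = blockPtr t S M := by
    rw [length_cat]; simp only [blockBits, length_bits]; rfl
  have hcol : ∀ q, ∑ k ∈ Finset.range 9, (colSection w t f M q S k).length ≤
      8 * (M * f) + 14 * (c * M) := by
    intro q
    have := hdata q
    simp only [Finset.sum_range_succ, Finset.sum_range_zero, colSection, stepWords, stepFields,
      groupFirst, groupFlag, groupPtr, monoTable, table, length_array]
    omega
  have hblock : ∑ k ∈ Finset.range 4, (blockSection w t f M S k).length ≤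
      blockPtr t S M + 2 * (M * f) + 2 * (c * M) := by
    simp only [Finset.sum_range_succ, Finset.sum_range_zero, blockSection, stepWords, stepFields,
      length_array, hcat]
    omega
  have hsum : ∑ k ∈ Finset.range 22, (sections w t f M S k).length =
      ∑ k ∈ Finset.range 4, (blockSection w t f M S k).length +
      ∑ k ∈ Finset.range 9, (colSection w t f M true S k).length +
      ∑ k ∈ Finset.range 9, (colSection w t f M false S k).length := by
    rw [show 22 = 4 + 9 + 9 by norm_num, Finset.sum_range_add, Finset.sum_range_add]
    refine congrArg₂ _ (congrArg₂ _ ?_ ?_) ?_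
    · refine Finset.sum_congr rfl fun k hk => ?_
      rw [Finset.mem_range] at hk
      rw [sections, if_pos hk]
    · refine Finset.sum_congr rfl fun k hk => ?_
      rw [Finset.mem_range] at hk
      rw [sections, if_neg (by omega), if_pos (by omega), Nat.add_sub_cancel_left]
    · refine Finset.sum_congr rfl fun k hk => ?_
      rw [sections, if_neg (by omega), if_neg (by omega), Nat.add_sub_cancel_left]
  have hpad : ∑ k ∈ Finset.range 22, words w (sections w t f M S k) * w ≤
      ∑ k ∈ Finset.range 22, (sections w t f M S k).length + 22 * w := by
    refine (Finset.sum_le_sum fun k _ => words_mul_le w _).trans ?_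
    rw [Finset.sum_add_distrib]
    simp
  rw [dictionary, length_layout hw, add_mul, Finset.sum_mul]
  have h1 := hcol true
  have h2 := hcol false
  have e : 50 * c * (M * f) = 50 * (c * (M * f)) := by ring
  rw [e]
  omega

/-! ### The information-theoretic bound -/

/-- The left side is one term of Vandermonde's sum. -/
theorem choose_mul_choose_le (a b c d : ℕ) :
    a.choose b * c.choose d ≤ (a + c).choose (b + d) := by
  rw [Nat.add_choose_eq]
  exact Finset.single_le_sum (f := fun ij : ℕ × ℕ => a.choose ij.1 * c.choose ij.2)
    (fun _ _ => Nat.zero_le _) (a := (b, d)) (by simp)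

theorem two_pow_blockLen_le {t k : ℕ} (hk : k ≤ t) : 2 ^ blockLen t k ≤ 2 * t.choose k := by
  have hpos : 0 < t.choose k := Nat.choose_pos hk
  rw [blockLen]
  rcases Nat.lt_or_ge 1 (t.choose k) with h | h
  · have h1 := Nat.pow_pred_clog_lt_self (b := 2) (by norm_num) h
    have h2 : 0 < Nat.clog 2 (t.choose k) := Nat.clog_pos (by norm_num) h
    obtain ⟨n, hn⟩ := Nat.exists_eq_add_of_lt h2
    rw [hn] at h1 ⊢
    simp only [zero_add, Nat.pred_eq_sub_one, Nat.add_sub_cancel] at h1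
    rw [zero_add, pow_succ]
    omega
  · have : t.choose k = 1 := by omega
    simp [this]

theorem count_block (t : ℕ) (S : Finset ℕ) (b : ℕ) :
    Nat.count (· ∈ S) (b * t + t) = Nat.count (· ∈ S) (b * t) + (block t S b).card := by
  rw [Nat.count_add, Nat.count_eq_card_filter_range (fun k => b * t + k ∈ S)]
  rfl

/-- Rounding a code length up costs at most a factor `2` per block, and the binomials of the blocks
merge by `choose_mul_choose_le`. -/
theorem two_pow_blockPtr_le (t : ℕ) (S : Finset ℕ) (b : ℕ) :
    2 ^ blockPtr t S b ≤ 2 ^ b * (b * t).choose (Nat.count (· ∈ S) (b * t)) := by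
  induction b with
  | zero => simp [blockPtr]
  | succ b ih =>
    rw [blockPtr, Finset.sum_range_succ, ← blockPtr, pow_add, add_mul, one_mul, count_block]
    calc _ ≤ (2 ^ b * (b * t).choose (Nat.count (· ∈ S) (b * t))) *
          (2 * t.choose (block t S b).card) :=
        Nat.mul_le_mul ih (two_pow_blockLen_le (card_block_le b))
      _ = 2 ^ (b + 1) * ((b * t).choose (Nat.count (· ∈ S) (b * t)) *
          t.choose (block t S b).card) := by ring
      _ ≤ _ := Nat.mul_le_mul_left _ (choose_mul_choose_le _ _ _ _)

theorem count_eq_card {m : ℕ} {S : Finset ℕ} (hS : S ⊆ Finset.range m) :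
    Nat.count (· ∈ S) m = S.card := by
  rw [Nat.count_eq_card_filter_range]
  congr 1
  ext y
  simp only [Finset.mem_filter]
  exact ⟨fun h => h.2, fun h => ⟨hS h, h⟩⟩

theorem choose_count_le {a m : ℕ} {S : Finset ℕ} (hS : S ⊆ Finset.range m) (ha : a ≤ m) :
    a.choose (Nat.count (· ∈ S) a) ≤ m.choose S.card := by
  obtain ⟨d, rfl⟩ := Nat.exists_eq_add_of_le ha
  rw [← count_eq_card hS, Nat.count_add]
  refine le_trans ?_ (choose_mul_choose_le _ _ _ _)
  exact Nat.le_mul_of_pos_right _ (Nat.choose_pos (Nat.count_le _))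

theorem blockPtr_le_infoBound {m : ℕ} (t : ℕ) {S : Finset ℕ} (hS : S ⊆ Finset.range m) :
    blockPtr t S (m / t + 1) ≤ infoBound S.card m + (m / t + t) := by
  -- The last block may stick out of `[m]`, so it is charged `t` bits; only the `m / t` full blocks
  -- are compared with the binomial.
  have h1 := blockPtr_succ_le (t := t) (S := S) (m / t)
  have hpos : 0 < m.choose S.card :=
    Nat.choose_pos (by simpa using Finset.card_le_card hS)
  have h2 : 2 ^ blockPtr t S (m / t) ≤ 2 ^ (m / t + infoBound S.card m) := by
    refine (two_pow_blockPtr_le t S (m / t)).trans ?_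
    rw [pow_add]
    refine Nat.mul_le_mul_left _ ((choose_count_le hS (Nat.div_mul_le_self m t)).trans ?_)
    have h3 : lg (m.choose S.card) ≤ infoBound S.card m := Nat.le_ceil _
    rw [lg, Real.logb_le_iff_le_rpow (by norm_num) (by exact_mod_cast hpos),
      Real.rpow_natCast] at h3
    exact_mod_cast h3
  have h3 := (Nat.pow_le_pow_iff_right (by norm_num)).mp h2
  omega

/-! ### From expressions to query programs -/

theorem Ev.eval_eq {w : ℕ} {D : List Bool} {x : BitVec w} {e : Expr} {n : ℕ} (h : Ev w D x e n) :
    e.eval (memOf w D) x = BitVec.ofInt w n := by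
  apply BitVec.eq_of_toNat_eq
  rw [BitVec.ofInt_natCast, BitVec.toNat_ofNat, Nat.mod_eq_of_lt h.lt]
  exact h

theorem ev_arg {w : ℕ} {D : List Bool} {y : ℕ} (hy : y < 2 ^ w) :
    Ev w D (BitVec.ofNat w y) .arg y := by
  simp [Ev, Expr.eval, Nat.mod_eq_of_lt hy]

/-- The expressions `R q` and `L q` compute the answers to the rank and select queries on `S`
(`q = true`) and on its complement. -/
structure Computes (w m : ℕ) (D : List Bool) (S : Finset ℕ) (R L : Bool → Expr) : Prop where
  rank : ∀ q, ∀ y < m, Col q S y → Ev w D (BitVec.ofNat w y) (R q) (Nat.count (Col q S) y)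
  rank_neg : ∀ q, ∀ y < m, ¬ Col q S y →
    (R q).eval (memOf w D) (BitVec.ofNat w y) = BitVec.ofInt w (-1)
  select : ∀ q, ∀ y < m, Col q S y →
    Ev w D (BitVec.ofNat w (Nat.count (Col q S) y + 1)) (L q) y

theorem card_filter_lt {A : Finset ℕ} {q : Bool} {S : Finset ℕ} {m x : ℕ}
    (hA : ∀ y, y ∈ A ↔ y < m ∧ Col q S y) (hx : x ≤ m) :
    (A.filter (· < x)).card = Nat.count (Col q S) x := by
  rw [Nat.count_eq_card_filter_range]
  congr 1
  ext y
  simp only [Finset.mem_filter, hA, Finset.mem_range]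
  constructor
  · rintro ⟨⟨-, h⟩, h'⟩; exact ⟨h', h⟩
  · rintro ⟨h', h⟩; exact ⟨⟨by omega, h⟩, h'⟩

theorem Computes.answers_rank {w m T : ℕ} {D : List Bool} {S A : Finset ℕ} {R L : Bool → Expr}
    {q : Bool} (h : Computes w m D S R L) (hA : ∀ y, y ∈ A ↔ y < m ∧ Col q S y)
    (hT : (R q).prog.length ≤ T) {x : ℕ} (hx : x < m) :
    Answers (R q).prog T w D x (FID.rank x A) := by
  apply Expr.prog_answers hT
  rw [FID.rank]
  by_cases hc : Col q S x
  · rw [if_pos ((hA x).mpr ⟨hx, hc⟩), card_filter_lt hA hx.le]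
    exact (h.rank q x hx hc).eval_eq
  · rw [if_neg fun hm => hc ((hA x).mp hm).2]
    exact h.rank_neg q x hx hc

/-- The `i`-th element of `A` is the one with `i - 1` predecessors, so it is enough that `L q`
inverts counting on `[m]`. This makes it irrelevant that the class `Col false S` continues beyond
`m`. -/
theorem Computes.answers_select {w m T : ℕ} {D : List Bool} {S A : Finset ℕ} {R L : Bool → Expr}
    {q : Bool} (h : Computes w m D S R L) (hA : ∀ y, y ∈ A ↔ y < m ∧ Col q S y)
    (hT : (L q).prog.length ≤ T) {i : ℕ} (h1 : 1 ≤ i) (hi : i ≤ A.card) :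
    Answers (L q).prog T w D i (FID.select i A) := by
  apply Expr.prog_answers hT
  have hcard : ∀ hf : (Set.ofPred (· ∈ A)).Finite, i - 1 < hf.toFinset.card := by
    intro hf
    have : hf.toFinset = A := by ext y; simp
    rw [this]; omega
  have hmem : FID.select i A ∈ A := Nat.nth_mem (p := (· ∈ A)) (i - 1) hcard
  have hcount : Nat.count (· ∈ A) (FID.select i A) = i - 1 := Nat.count_nth hcard
  obtain ⟨hlt, hcol⟩ := (hA _).mp hmem
  have h2 := h.select q _ hlt hcol
  rw [← card_filter_lt hA hlt.le] at h2
  rw [Nat.count_eq_card_filter_range] at hcount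
  have h3 : (A.filter (· < FID.select i A)).card = i - 1 := by
    rw [← hcount]
    congr 1
    ext y
    simp only [Finset.mem_filter, Finset.mem_range]
    tauto
  rw [h3, Nat.sub_add_cancel h1] at h2
  exact h2.eval_eq

theorem Computes.represents {w m T : ℕ} {D : List Bool} {S : Finset ℕ} {R L : Bool → Expr}
    (h : Computes w m D S R L) (hS : S ⊆ Finset.range m)
    (hR : ∀ q, (R q).prog.length ≤ T) (hL : ∀ q, (L q).prog.length ≤ T) :
    Represents ⟨(R true).prog, (L true).prog, (R false).prog, (L false).prog⟩ T w m D S := by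
  have h1 : ∀ y, y ∈ S ↔ y < m ∧ Col true S y := by
    intro y
    simp only [Col, decide_eq_true_eq]
    exact ⟨fun hy => ⟨Finset.mem_range.mp (hS hy), hy⟩, fun hy => hy.2⟩
  have h0 : ∀ y, y ∈ Finset.range m \ S ↔ y < m ∧ Col false S y := by
    intro y
    simp [Col]
  exact ⟨fun x hx => h.answers_rank h1 (hR _) hx,
    fun i hi hiS => h.answers_select h1 (hL _) hi hiS,
    fun x hx => h.answers_rank h0 (hR _) hx,
    fun i hi hiS => h.answers_select h0 (hL _) hi hiS⟩

/-! ### Small universes -/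

/-- Whether `k` is in the set, if the characteristic sequence is in the words `1, 2, …`. -/
def bitE (q : Bool) (k : Expr) : Expr :=
  if q then .load (k + .const 1) else .const 1 - .load (k + .const 1)

/-- The number of elements from `k` up to the argument, by inspection of at most `n` positions. -/
def countE (q : Bool) : ℕ → ℕ → Expr
  | 0, _ => .const 0
  | n + 1, k => .ite (.const k) .arg (bitE q (.const k) + countE q n (k + 1)) (.const 0)

/-- The first position from `k` on where the number of elements, `j` of them before `k`, reaches
the argument. -/
def findE (q : Bool) : ℕ → ℕ → ℕ → Expr
  | 0, _, _ => .const 0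
  | n + 1, k, j =>
    .ite (.const 0) (bitE q (.const k))
      (.ite (.const (j + 1)) .arg (findE q n (k + 1) (j + 1)) (.const k)) (findE q n (k + 1) j)

def scanRankE (q : Bool) (n : ℕ) : Expr :=
  .ite (.const 0) (bitE q .arg) (countE q n 0) (.const 0 - .const 1)

/-- The characteristic sequence, one word for each position, after a word `0`. -/
def scanBits (w m : ℕ) (S : Finset ℕ) : List Bool :=
  array w (m + 1) fun k => if 1 ≤ k ∧ k - 1 ∈ S then 1 else 0

section Scan

variable {w m : ℕ} {S : Finset ℕ} {x : BitVec w} {q : Bool}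

theorem ev_bitE (hw : 0 < w) (hm : m < 2 ^ w) {k : ℕ} {e : Expr}
    (he : Ev w (scanBits w m S) x e k) (hk : k < m) :
    Ev w (scanBits w m S) x (bitE q e) (if Col q S k then 1 else 0) := by
  have h1 : 1 < 2 ^ w := Nat.one_lt_two_pow (by omega)
  have hc : Ev w (scanBits w m S) x (.const 1) 1 := ev_const h1
  have hb : Ev w (scanBits w m S) x (.load (e + .const 1)) (if k ∈ S then 1 else 0) := by
    refine ev_load_bits (he.add hc (by omega)) ?_ (by split_ifs <;> omega)
    have := at_array (len := w) (K := m + 1) (fun k => if 1 ≤ k ∧ k - 1 ∈ S then 1 else 0)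
      (i := k + 1) (by omega)
    simpa [scanBits] using this
  cases q
  · have := hc.sub hb (by split_ifs <;> omega)
    by_cases hS : k ∈ S <;> simpa [bitE, Col, hS] using this
  · simpa [bitE, Col] using hb

theorem ev_countE (hw : 0 < w) (hm : m < 2 ^ w) {y : ℕ}
    (hy : Ev w (scanBits w m S) x .arg y) (hym : y < m) :
    ∀ n k, k ≤ y → y - k ≤ n →
      ∃ r, Ev w (scanBits w m S) x (countE q n k) r ∧
        Nat.count (Col q S) k + r = Nat.count (Col q S) y := by
  have h0 : Ev w (scanBits w m S) x (.const 0) 0 := ev_const (by positivity)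
  intro n
  induction n with
  | zero =>
    intro k hk hn
    obtain rfl : k = y := by omega
    exact ⟨0, h0, rfl⟩
  | succ n ih =>
    intro k hk hn
    have hkc : Ev w (scanBits w m S) x (.const k) k := ev_const (by omega)
    rcases hk.lt_or_eq with hlt | rfl
    · obtain ⟨r, hr, hsum⟩ := ih (k + 1) hlt (by omega)
      rw [Nat.count_succ] at hsum
      have hle : Nat.count (Col q S) y ≤ y := Nat.count_le _
      exact ⟨_, Ev.ite_pos hkc hy hlt ((ev_bitE hw hm hkc (by omega)).add hr (by omega)),
        by omega⟩
    · exact ⟨0, Ev.ite_neg hkc hy (lt_irrefl k) h0, rfl⟩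

theorem ev_findE (hw : 0 < w) (hm : m < 2 ^ w) {y : ℕ} (hym : y < m) (hcol : Col q S y)
    (hx : Ev w (scanBits w m S) x .arg (Nat.count (Col q S) y + 1)) :
    ∀ n k, k ≤ y → y - k < n →
      Ev w (scanBits w m S) x (findE q n k (Nat.count (Col q S) k)) y := by
  have h0 : Ev w (scanBits w m S) x (.const 0) 0 := ev_const (by positivity)
  intro n
  induction n with
  | zero => intro k hk hn; omega
  | succ n ih =>
    intro k hk hn
    have hkc : Ev w (scanBits w m S) x (.const k) k := ev_const (by omega)
    have hbit := ev_bitE (q := q) (S := S) hw hm hkc (by omega)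
    by_cases hc : Col q S k
    · have hs : Nat.count (Col q S) (k + 1) = Nat.count (Col q S) k + 1 := by
        rw [Nat.count_succ, if_pos hc]
      have hjc : Ev w (scanBits w m S) x (.const (Nat.count (Col q S) k + 1))
          (Nat.count (Col q S) k + 1) := by
        have : Nat.count (Col q S) k ≤ k := Nat.count_le _
        exact ev_const (by omega)
      rw [if_pos hc] at hbit
      refine Ev.ite_pos h0 hbit one_pos ?_
      rcases hk.lt_or_eq with hlt | rfl
      · have hmono : Nat.count (Col q S) (k + 1) ≤ Nat.count (Col q S) y :=
          Nat.count_monotone _ hlt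
        refine Ev.ite_pos hjc hx (by omega) ?_
        rw [← hs]
        exact ih (k + 1) hlt (by omega)
      · exact Ev.ite_neg hjc hx (lt_irrefl _) hkc
    · have hs : Nat.count (Col q S) (k + 1) = Nat.count (Col q S) k := by
        rw [Nat.count_succ, if_neg hc, add_zero]
      rw [if_neg hc] at hbit
      refine Ev.ite_neg h0 hbit (lt_irrefl 0) ?_
      have hne : k ≠ y := by rintro rfl; exact hc hcol
      rw [← hs]
      exact ih (k + 1) (by omega) (by omega)

/-- One pair of expressions serves all universes of size at most `n`. The size of `findE` is
exponential in `n`, which is harmless because `n` will be an absolute constant. -/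
theorem scan_computes {n : ℕ} (hw : 0 < w) (hm : m < 2 ^ w) (hn : m ≤ n) :
    Computes w m (scanBits w m S) S (fun q => scanRankE q n) (fun q => findE q n 0 0) := by
  refine ⟨fun q y hy hc => ?_, fun q y hy hc => ?_, fun q y hy hc => ?_⟩
  · have ha : Ev w (scanBits w m S) (BitVec.ofNat w y) .arg y := ev_arg (by omega)
    obtain ⟨r, hr, hsum⟩ := ev_countE (q := q) hw hm ha hy n 0 (by omega) (by omega)
    rw [Nat.count_zero, zero_add] at hsum
    have hb := ev_bitE (q := q) hw hm ha hy
    rw [if_pos hc] at hb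
    exact Ev.ite_pos (ev_const (by positivity)) hb one_pos (hsum ▸ hr)
  · have ha : Ev w (scanBits w m S) (BitVec.ofNat w y) .arg y := ev_arg (by omega)
    have hb := ev_bitE (q := q) hw hm ha hy
    rw [if_neg hc] at hb
    rw [← eval_neg_one (D := scanBits w m S) (x := BitVec.ofNat w y)]
    apply BitVec.eq_of_toNat_eq
    exact Ev.ite_neg (ev_const (by positivity)) hb (lt_irrefl 0) rfl
  · have hle : Nat.count (Col q S) y ≤ y := Nat.count_le _
    have := ev_findE (q := q) hw hm hy hc (ev_arg (by omega)) n 0 (by omega) (by omega)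
    rwa [Nat.count_zero] at this

end Scan

/-! ### The two cases -/

/-- The first memory word tells which of two representations is used. -/
def orE (a b : Bool → Expr) (q : Bool) : Expr :=
  .ite (.const 0) (.load (.const 0)) (a q) (b q)

theorem Computes.or_left {w m : ℕ} {D : List Bool} {S : Finset ℕ} {R L R' L' : Bool → Expr}
    (h : Computes w m D S R L) (hD : rd D (0 * w) w = 1) :
    Computes w m D S (orE R R') (orE L L') := by
  have h0 : ∀ x, Ev w D x (.const 0) 0 := fun x => ev_const (by positivity)
  have h1 : ∀ x, Ev w D x (.load (.const 0)) 1 := fun x => hD ▸ (h0 x).load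
  refine ⟨fun q y hy hc => ?_, fun q y hy hc => ?_, fun q y hy hc => ?_⟩
  · exact Ev.ite_pos (h0 _) (h1 _) one_pos (h.rank q y hy hc)
  · rw [← h.rank_neg q y hy hc]
    exact BitVec.eq_of_toNat_eq (Ev.ite_pos (h0 _) (h1 _) one_pos rfl)
  · exact Ev.ite_pos (h0 _) (h1 _) one_pos (h.select q y hy hc)

theorem Computes.or_right {w m : ℕ} {D : List Bool} {S : Finset ℕ} {R L R' L' : Bool → Expr}
    (h : Computes w m D S R L) (hD : rd D (0 * w) w = 0) :
    Computes w m D S (orE R' R) (orE L' L) := by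
  have h0 : ∀ x, Ev w D x (.const 0) 0 := fun x => ev_const (by positivity)
  have h1 : ∀ x, Ev w D x (.load (.const 0)) 0 := fun x => by
    have := (h0 x).load
    rwa [hD] at this
  refine ⟨fun q y hy hc => ?_, fun q y hy hc => ?_, fun q y hy hc => ?_⟩
  · exact Ev.ite_neg (h0 _) (h1 _) (lt_irrefl 0) (h.rank q y hy hc)
  · rw [← h.rank_neg q y hy hc]
    exact BitVec.eq_of_toNat_eq (Ev.ite_neg (h0 _) (h1 _) (lt_irrefl 0) rfl)
  · exact Ev.ite_neg (h0 _) (h1 _) (lt_irrefl 0) (h.select q y hy hc)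

theorem rd_scanBits (w m : ℕ) (S : Finset ℕ) : rd (scanBits w m S) (0 * w) w = 0 := by
  have := at_array (len := w) (K := m + 1) (fun k => if 1 ≤ k ∧ k - 1 ∈ S then 1 else 0)
    (i := 0) (by omega)
  exact At.rd_bits this (by simp)

theorem Stored.computes {w t f m : ℕ} {S : Finset ℕ} {D : List Bool}
    (hs : Stored w t f (m / t + 1) S D) (hm : m < 2 ^ w) :
    Computes w m D S rankE selectE := by
  have ht0 : 0 < t := by have := hs.le_t; omega
  refine ⟨fun q y hy hc => ?_, fun q y hy hc => ?_, fun q y hy hc => ?_⟩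
  · exact (hs.ev_rankE (ev_arg (by omega))
      (Nat.lt_succ_of_le (Nat.div_le_div_right hy.le))).1 hc
  · exact (hs.ev_rankE (ev_arg (by omega))
      (Nat.lt_succ_of_le (Nat.div_le_div_right hy.le))).2 hc
  · have hle : Nat.count (Col q S) y ≤ y := Nat.count_le _
    have hnth : Nat.nth (Col q S) (Nat.count (Col q S) y + 1 - 1) = y := by
      rw [Nat.add_sub_cancel, Nat.nth_count hc]
    have hlt : Nat.count (Col q S) y < blockRank t q S (m / t + 1) := by
      have h1 : Nat.count (Col q S) (y + 1) ≤ blockRank t q S (m / t + 1) := by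
        refine Nat.count_monotone _ ?_
        have := Nat.lt_div_mul_add (a := m) ht0
        rw [add_mul]; omega
      rw [Nat.count_succ, if_pos hc] at h1
      omega
    have := hs.ev_selectE (q := q) (i := Nat.count (Col q S) y + 1) (ev_arg (w := w) (D := D)
      (by omega)) (by omega) (by rwa [Nat.add_sub_cancel]) (by rw [hnth]; omega)
    rwa [hnth] at this

/-! ### Parameters -/

/-- The block length for the universe `{0, …, m - 1}`. -/
def blockSize (m : ℕ) : ℕ := Nat.log 2 m / 8

/-- The length of short fields. -/
def fieldSize (m : ℕ) : ℕ := 4 * (Nat.log 2 (blockSize m) + 1)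

theorem eight_mul_add_le_two_pow {n : ℕ} (hn : 6 ≤ n) : 8 * (n + 1) ≤ 2 ^ n := by
  induction n, hn using Nat.le_induction with
  | base => norm_num
  | succ n hn ih => rw [pow_succ]; omega

theorem pow_four_le_two_pow_fieldSize (m : ℕ) : blockSize m ^ 4 ≤ 2 ^ fieldSize m := by
  rw [fieldSize, mul_comm, pow_mul]
  exact Nat.pow_le_pow_left (Nat.lt_pow_succ_log_self (by norm_num) _).le 4

theorem two_mul_fieldSize_le {m : ℕ} (h : 1000 ≤ blockSize m) :
    2 * fieldSize m ≤ blockSize m := by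
  have h1 : 6 ≤ Nat.log 2 (blockSize m) := by
    apply Nat.le_log_of_pow_le (by norm_num)
    omega
  have h2 := eight_mul_add_le_two_pow h1
  have h3 := Nat.pow_log_le_self 2 (x := blockSize m) (by omega)
  rw [fieldSize]
  omega

theorem two_pow_blockSize_le {m : ℕ} (hm : m ≠ 0) : 2 ^ (8 * blockSize m) ≤ m :=
  (Nat.pow_le_pow_right two_pos (Nat.mul_div_le _ 8)).trans (Nat.pow_log_le_self 2 hm)

/-- The divisor `8` in `blockSize` is what makes the tables small: `t ^ 4 * 2 ^ (2 * t) ≤ 2 ^ (6 *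
t) ≤ m`. -/
theorem pow_three_mul_le {m : ℕ} (hm : m ≠ 0) (h : 1000 ≤ blockSize m) :
    blockSize m ^ 3 * 2 ^ (2 * blockSize m) ≤ m / blockSize m + 1 := by
  have h1 := two_pow_blockSize_le hm
  set t := blockSize m
  refine le_trans ?_ (Nat.le_succ _)
  rw [Nat.le_div_iff_mul_le (by omega)]
  refine le_trans ?_ h1
  calc t ^ 3 * 2 ^ (2 * t) * t = t ^ 4 * 2 ^ (2 * t) := by ring
    _ ≤ (2 ^ t) ^ 4 * 2 ^ (2 * t) :=
      Nat.mul_le_mul_right _ (Nat.pow_le_pow_left Nat.lt_two_pow_self.le 4)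
    _ = 2 ^ (6 * t) := by rw [← pow_mul, ← pow_add]; congr 1; ring
    _ ≤ 2 ^ (8 * t) := Nat.pow_le_pow_right two_pos (by omega)

theorem blockSize_le_of_lt {m w : ℕ} (hm : m ≠ 0) (hw : m < 2 ^ w) : 8 * blockSize m ≤ w := by
  have := (two_pow_blockSize_le hm).trans_lt hw
  exact ((Nat.pow_lt_pow_iff_right (by norm_num)).mp this).le

theorem blockSize_le_self {m : ℕ} (hm : m ≠ 0) : blockSize m ≤ m := by
  have h1 := two_pow_blockSize_le hm
  have h2 : 8 * blockSize m < 2 ^ (8 * blockSize m) := Nat.lt_two_pow_self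
  omega

/-- The dictionary with the parameters for the universe `{0, …, m - 1}`. -/
noncomputable def fid (w m : ℕ) (S : Finset ℕ) : List Bool :=
  dictionary w (blockSize m) (fieldSize m) (m / blockSize m + 1) S

theorem length_fid_le {w m c : ℕ} {S : Finset ℕ} (hm : m ≠ 0) (h : 1000 ≤ blockSize m)
    (hw : 0 < w) (hwc : w ≤ c * blockSize m) (hS : S ⊆ Finset.range m) :
    (fid w m S).length ≤ infoBound S.card m +
      52 * c * ((m / blockSize m + 1) * fieldSize m) := by
  have hf : 1 ≤ fieldSize m := by rw [fieldSize]; omega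
  have h1 := length_dictionary_le (f := fieldSize m) S (by omega) hw hf hwc (pow_three_mul_le hm h)
  have h2 := blockPtr_le_infoBound (blockSize m) hS
  have h3 := pow_three_mul_le hm h
  have h4 : blockSize m ≤ blockSize m ^ 3 * 2 ^ (2 * blockSize m) := by
    calc blockSize m = blockSize m * 1 := by ring
      _ ≤ _ := Nat.mul_le_mul (Nat.le_self_pow (by norm_num) _) Nat.one_le_two_pow
  have hc : 1 ≤ c := by
    rcases Nat.eq_zero_or_pos c with rfl | h
    · omega
    · exact h
  rw [fid]
  set M := m / blockSize m + 1
  have h5 : M ≤ c * (M * fieldSize m) :=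
    (Nat.le_mul_of_pos_right _ hf).trans (Nat.le_mul_of_pos_left _ hc)
  have e1 : 50 * c * (M * fieldSize m) = 50 * (c * (M * fieldSize m)) := by ring
  have e2 : 52 * c * (M * fieldSize m) = 52 * (c * (M * fieldSize m)) := by ring
  omega

theorem fid_stored {w m : ℕ} {S : Finset ℕ} (h : 1000 ≤ blockSize m) (hmw : m < 2 ^ w)
    (hm : m ≠ 0) : Stored w (blockSize m) (fieldSize m) (m / blockSize m + 1) S (fid w m S) := by
  have hft := two_mul_fieldSize_le h
  have hwt := blockSize_le_of_lt hm hmw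
  have htm := blockSize_le_self hm
  have hw : 0 < w := by omega
  have hf : 1 ≤ fieldSize m := by rw [fieldSize]; omega
  have hdm := Nat.div_mul_le_self m (blockSize m)
  -- No bound `w = O(lg m)` is available here; `w / t + 1` takes the role of the constant, because
  -- only addressability is at stake.
  have hlen : (fid w m S).length ≤ blockPtr (blockSize m) S (m / blockSize m + 1) +
      50 * (w / blockSize m + 1) * ((m / blockSize m + 1) * fieldSize m) := by
    refine length_dictionary_le (f := fieldSize m) S (by omega) hw hf ?_ (pow_three_mul_le hm h)
    have := Nat.lt_div_mul_add (a := w) (b := blockSize m) (by omega)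
    rw [add_mul]; omega
  have hptr := blockPtr_le (t := blockSize m) (S := S) (m / blockSize m + 1)
  have hbig : 1000 * (m / blockSize m) ≤ m := by
    calc 1000 * (m / blockSize m) ≤ blockSize m * (m / blockSize m) := Nat.mul_le_mul_right _ h
      _ ≤ m := Nat.mul_div_le _ _
  have hm8 : 8000 ≤ m := by
    have h1 := two_pow_blockSize_le hm
    have h2 : 8 * blockSize m < 2 ^ (8 * blockSize m) := Nat.lt_two_pow_self
    omega
  have hwdiv := Nat.div_mul_le_self w (blockSize m)
  refine dictionary_stored hwt (by omega) (by omega) (pow_four_le_two_pow_fieldSize m) ?_ ?_ ?_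
  · have h1 : (m / blockSize m + 1) * (2 * fieldSize m) ≤ (m / blockSize m + 1) * blockSize m :=
      Nat.mul_le_mul_left _ hft
    have h2 : (m / blockSize m + 1) * (2 * fieldSize m) =
      2 * ((m / blockSize m + 1) * fieldSize m) := by ring
    rw [h2, add_mul _ _ (blockSize m), one_mul] at h1
    omega
  · intro b hb
    have : b * blockSize m ≤ m / blockSize m * blockSize m :=
      Nat.mul_le_mul_right _ (by omega)
    omega
  · set t := blockSize m
    set f := fieldSize m
    set d := m / t
    have h1 : (w / t + 1) * f ≤ 2 * w := by
      calc (w / t + 1) * f ≤ (w / t + 1) * t := Nat.mul_le_mul_left _ (by omega)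
        _ = w / t * t + t := by ring
        _ ≤ 2 * w := by omega
    have h2 : 50 * (w / t + 1) * ((d + 1) * f) ≤ 100 * (d + 1) * w := by
      calc 50 * (w / t + 1) * ((d + 1) * f) = 50 * (d + 1) * ((w / t + 1) * f) := by ring
        _ ≤ 50 * (d + 1) * (2 * w) := Nat.mul_le_mul_left _ h1
        _ = _ := by ring
    have h3 : (d + 1) * t ≤ (d + 1) * w := Nat.mul_le_mul_left _ (by omega)
    -- From `1000 * d ≤ m` and `8000 ≤ m` the number of words is below `m < 2 ^ w`.
    have h4 : (101 * (d + 1) + 1) * w < 2 ^ w * w := by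
      refine Nat.mul_lt_mul_of_pos_right ?_ hw
      omega
    rw [← fid]
    have e : (101 * (d + 1) + 1) * w = 100 * (d + 1) * w + (d + 1) * w + w := by ring
    omega

/-! ### Real estimates -/

theorem one_lt_lg_three : 1 < lg 3 := by
  rw [lg, Real.lt_logb_iff_rpow_lt (by norm_num) (by norm_num)]
  norm_num

theorem lg_mono {x y : ℝ} (hx : 0 < x) (h : x ≤ y) : lg x ≤ lg y :=
  Real.logb_le_logb_of_le (by norm_num) hx h

theorem lg_pos_of_three_le {m : ℕ} (hm : 3 ≤ m) : 1 < lg m :=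
  one_lt_lg_three.trans_le (lg_mono (by norm_num) (by exact_mod_cast hm))

theorem lg_le_self {x : ℝ} (hx : 0 < x) : lg x ≤ x := by
  rw [lg, Real.logb_le_iff_le_rpow (by norm_num) hx]
  have h1 := Real.add_one_le_exp (x * Real.log 2)
  rw [Real.rpow_def_of_pos (by norm_num), mul_comm]
  rcases le_or_gt 1 x with h | h
  · have h2 := one_add_mul_self_le_rpow_one_add (s := 1) (by norm_num) h
    rw [show (1 : ℝ) + 1 = 2 by norm_num, Real.rpow_def_of_pos (by norm_num), mul_comm (Real.log 2)]
      at h2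
    linarith
  · have : 0 ≤ x * Real.log 2 := mul_nonneg hx.le (Real.log_nonneg (by norm_num))
    linarith

/-- The redundancy is bounded away from zero. -/
theorem lg_lg_three_le {m : ℕ} (hm : 3 ≤ m) :
    lg (lg 3) ≤ m * lg (lg m) / lg m := by
  have h1 := lg_pos_of_three_le hm
  have h3 : (3 : ℝ) ≤ m := by exact_mod_cast hm
  have h2 : lg (lg 3) ≤ lg (lg m) :=
    lg_mono (by linarith [one_lt_lg_three]) (lg_mono (by norm_num) h3)
  have h4 : 0 ≤ lg (lg 3) := Real.logb_nonneg (by norm_num) one_lt_lg_three.le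
  rw [le_div_iff₀ (by linarith)]
  have h5 := lg_le_self (x := m) (by linarith)
  nlinarith

theorem lg_lg_three_pos : 0 < lg (lg 3) := Real.logb_pos (by norm_num) one_lt_lg_three

theorem natLog_le_lg {n : ℕ} (hn : n ≠ 0) : (Nat.log 2 n : ℝ) ≤ lg n := by
  have hpos : (0 : ℝ) < n := by exact_mod_cast Nat.pos_of_ne_zero hn
  rw [lg, Real.le_logb_iff_rpow_le (by norm_num) hpos, Real.rpow_natCast]
  exact_mod_cast Nat.pow_log_le_self 2 hn

/-- Two floors lose less than `8` in all, and `8 * t + 8 ≤ 9 * t`. -/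
theorem lg_le_mul_blockSize {m : ℕ} (hm : m ≠ 0) (h : 1000 ≤ blockSize m) :
    lg m ≤ 9 * blockSize m := by
  have hpos : (0 : ℝ) < m := by exact_mod_cast Nat.pos_of_ne_zero hm
  have h1 : m < 2 ^ (9 * blockSize m) :=
    (Nat.lt_pow_succ_log_self (b := 2) (by norm_num) m).trans_le
      (Nat.pow_le_pow_right two_pos (by
        rw [blockSize] at h ⊢
        omega))
  rw [lg, Real.logb_le_iff_le_rpow (by norm_num) hpos]
  have : ((9 * blockSize m : ℕ) : ℝ) = 9 * (blockSize m : ℝ) := by push_cast; ring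
  rw [← this, Real.rpow_natCast]
  exact_mod_cast h1.le

theorem fieldSize_le_lg_lg {m : ℕ} (hm : m ≠ 0) (h : 1000 ≤ blockSize m) :
    (fieldSize m : ℝ) ≤ 4 * lg (lg m) := by
  have h1 : (8 * blockSize m : ℝ) ≤ lg m := by
    refine le_trans ?_ (natLog_le_lg hm)
    exact_mod_cast Nat.mul_div_le (Nat.log 2 m) 8
  have ht : (0 : ℝ) < blockSize m := by exact_mod_cast (by omega : 0 < blockSize m)
  have h2 : lg (2 * blockSize m) ≤ lg (lg m) := lg_mono (by positivity) (by linarith)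
  have h3 : lg (2 * blockSize m) = 1 + lg (blockSize m) := by
    rw [lg, Real.logb_mul (by norm_num) ht.ne', Real.logb_self_eq_one (by norm_num), lg]
  have h4 := natLog_le_lg (n := blockSize m) (by omega)
  rw [fieldSize]
  push_cast
  linarith

/-- Here `72 = 2 * 9 * 4`: there are at most `2 * m / t` blocks, `lg m ≤ 9 * t`, and fields have at
most `4 * lg (lg m)` bits. -/
theorem mul_fieldSize_le {m : ℕ} (hm : 3 ≤ m) (h : 1000 ≤ blockSize m) :
    (((m / blockSize m + 1) * fieldSize m : ℕ) : ℝ) ≤ 72 * (m * lg (lg m) / lg m) := by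
  have hm0 : m ≠ 0 := by omega
  have hl := lg_pos_of_three_le hm
  have hlog := lg_le_mul_blockSize hm0 h
  have hf := fieldSize_le_lg_lg hm0 h
  have ht : (0 : ℝ) < blockSize m := by exact_mod_cast (by omega : 0 < blockSize m)
  have hmt : (blockSize m : ℝ) ≤ m := by exact_mod_cast blockSize_le_self hm0
  have h1 : ((m / blockSize m : ℕ) : ℝ) ≤ m / blockSize m := Nat.cast_div_le
  have h2 : (1 : ℝ) ≤ m / blockSize m := by rwa [le_div_iff₀ ht, one_mul]
  have h3 : (m : ℝ) / blockSize m ≤ 9 * m / lg m := by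
    rw [div_le_div_iff₀ ht (by linarith)]
    have : (0 : ℝ) ≤ m := by positivity
    nlinarith
  have hf0 : (0 : ℝ) ≤ fieldSize m := by positivity
  push_cast
  calc (((m / blockSize m : ℕ) : ℝ) + 1) * fieldSize m
      ≤ (2 * (9 * m / lg m)) * (4 * lg (lg m)) := by
        refine mul_le_mul (by linarith) hf hf0 ?_
        have : (0 : ℝ) < lg m := by linarith
        positivity
    _ = 72 * (m * lg (lg m) / lg m) := by ring

theorem exists_large_blockSize : ∃ N, ∀ m, N ≤ m → 1000 ≤ blockSize m := by
  refine ⟨2 ^ (8 * 1000), fun m hm => ?_⟩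
  have := Nat.le_log_of_pow_le (by norm_num : 1 < 2) hm
  rw [blockSize]
  omega

end FID

/-! ### Assembly of the two representations. -/

theorem mainTheorem3 :
    ∃ (Q : FID.Queries) (T : ℕ), ∀ c : ℝ, ∃ C : ℝ, ∀ m w n : ℕ,
      3 ≤ m → m < 2 ^ w → (w : ℝ) ≤ c * FID.lg m →
      ∀ S : Finset ℕ, S ⊆ Finset.range m → S.card = n →
        ∃ D : List Bool,
          (D.length : ℝ) ≤ FID.infoBound n m + C * (m * FID.lg (FID.lg m) / FID.lg m) ∧
          FID.Represents Q T w m D S := by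
  obtain ⟨N, hN⟩ := FID.exists_large_blockSize
  let R : Bool → FID.Expr := FID.orE FID.rankE fun q => FID.scanRankE q N
  let L : Bool → FID.Expr := FID.orE FID.selectE fun q => FID.findE q N 0 0
  let T := max (max (R true).prog.length (R false).prog.length)
    (max (L true).prog.length (L false).prog.length)
  have hRT : ∀ q, (R q).prog.length ≤ T := by rintro (_ | _) <;> simp [T]
  have hLT : ∀ q, (L q).prog.length ≤ T := by rintro (_ | _) <;> simp [T]
  refine ⟨⟨(R true).prog, (L true).prog, (R false).prog, (L false).prog⟩, T, fun c => ?_⟩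
  -- For `m < N` the scanned string has `(m + 1) * w ≤ (N + 1) * (|c| * N)` bits, because `lg m ≤
  -- m`; dividing by the least redundancy `lg (lg 3)` gives the constant.
  let A : ℝ := (N + 1) * (|c| * N) / FID.lg (FID.lg 3)
  -- From `lg m ≤ 9 * t` follows `w ≤ ⌈9 * c⌉₊ * t`; the factors `52` and `72` come from
  -- `length_fid_le` and `mul_fieldSize_le`.
  let B : ℝ := 52 * ⌈9 * c⌉₊ * 72
  have hlg3 := FID.lg_lg_three_pos
  have hA : 0 ≤ A := by positivity
  have hB : 0 ≤ B := by positivity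
  refine ⟨A + B, fun m w n hm hmw hwc S hS hn => ?_⟩
  subst hn
  have hw : 0 < w := by
    rcases Nat.eq_zero_or_pos w with rfl | h
    · omega
    · exact h
  have hred := FID.lg_lg_three_le hm
  have hlgm := FID.lg_pos_of_three_le hm
  rcases Nat.lt_or_ge m N with hmN | hmN
  · refine ⟨FID.scanBits w m S, ?_, ((FID.scan_computes hw hmw hmN.le).or_right
      (FID.rd_scanBits w m S)).represents hS hRT hLT⟩
    have hlen : ((FID.scanBits w m S).length : ℝ) = (m + 1) * w := by
      simp [FID.scanBits]
    have hmN' : (m : ℝ) ≤ N := by exact_mod_cast hmN.le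
    have hw' : (w : ℝ) ≤ |c| * N := by
      refine hwc.trans (mul_le_mul (le_abs_self c) ?_ (by linarith) (abs_nonneg c))
      exact (FID.lg_le_self (by exact_mod_cast (by omega : 0 < m))).trans hmN'
    have h1 : ((m : ℝ) + 1) * w ≤ (N + 1) * (|c| * N) :=
      mul_le_mul (by linarith) hw' (by positivity) (by positivity)
    have h2 : ((N : ℝ) + 1) * (|c| * N) = A * FID.lg (FID.lg 3) := by
      simp only [A]
      field_simp
    have h3 : A * FID.lg (FID.lg 3) ≤ (A + B) * (m * FID.lg (FID.lg m) / FID.lg m) :=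
      mul_le_mul (by linarith) hred hlg3.le (by linarith)
    have h4 : (0 : ℝ) ≤ FID.infoBound S.card m := by positivity
    rw [hlen]
    linarith
  · have ht := hN m hmN
    have hm0 : m ≠ 0 := by omega
    have hst := FID.fid_stored (S := S) ht hmw hm0
    have hone : FID.rd (FID.fid w m S) (0 * w) w = 1 :=
      FID.rd_layout (k := 0) (by norm_num) (Nat.one_lt_two_pow hw.ne')
    refine ⟨FID.fid w m S, ?_, ((hst.computes hmw).or_left hone).represents hS hRT hLT⟩
    have hc0 : 0 ≤ c := by
      by_contra! hneg
      have : (0 : ℝ) < w := by exact_mod_cast hw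
      nlinarith
    have hwc' : w ≤ ⌈9 * c⌉₊ * FID.blockSize m := by
      have h1 := FID.lg_le_mul_blockSize hm0 ht
      have h2 : (w : ℝ) ≤ ⌈9 * c⌉₊ * FID.blockSize m := by
        calc (w : ℝ) ≤ c * FID.lg m := hwc
          _ ≤ c * (9 * FID.blockSize m) := mul_le_mul_of_nonneg_left h1 hc0
          _ = (9 * c) * FID.blockSize m := by ring
          _ ≤ _ := mul_le_mul_of_nonneg_right (Nat.le_ceil _) (by positivity)
      exact_mod_cast h2
    have h1 := FID.length_fid_le hm0 ht hw hwc' hS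
    have h2 := FID.mul_fieldSize_le hm ht
    have h3 : ((FID.fid w m S).length : ℝ) ≤ FID.infoBound S.card m +
        52 * ⌈9 * c⌉₊ * (((m / FID.blockSize m + 1) * FID.fieldSize m : ℕ) : ℝ) := by
      exact_mod_cast h1
    have h4 : (52 * ⌈9 * c⌉₊ : ℝ) * (((m / FID.blockSize m + 1) * FID.fieldSize m : ℕ) : ℝ) ≤
        (52 * ⌈9 * c⌉₊ : ℝ) * (72 * (m * FID.lg (FID.lg m) / FID.lg m)) :=
      mul_le_mul_of_nonneg_left h2 (by positivity)
    have h5 : (52 * ⌈9 * c⌉₊ : ℝ) * (72 * (m * FID.lg (FID.lg m) / FID.lg m)) =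
        B * (m * FID.lg (FID.lg m) / FID.lg m) := by
      simp only [B]; ring
    have h6 : 0 ≤ A * (m * FID.lg (FID.lg m) / FID.lg m) :=
      mul_nonneg hA (hlg3.le.trans hred)
    rw [add_mul]
    linarith
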